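/- Let $G$ be a graph, that is, a finite connected CW complex all of whose cells have dimension at most $1$, and let $\chi(G)$ be its Euler characteristic, the number of its vertices minus the number of its edges. For a natural number $n$ let $\mathrm{Conf}_n(G)=\{(x_1,\dots,x_n)\in G^n : x_i\ne x_j \text{ for } i\ne j\}$ be the $n$-th ordered configuration space of $G$, with the subspace topology of the product $G^n$, and let $\phi_{n+1}:\mathrm{Conf}_{n+1}(G)\to\mathrm{Conf}_n(G)$ be the forgetting map $(x_1,\dots,x_{n+1})\mapsto(x_1,\dots,x_n)$. Suppose that $\chi(G)<0$ and $n\ge 2-\chi(G)$. Then $\phi_{n+1}$ has no section: there is no continuous map $s:\mathrm{Conf}_n(G)\to\mathrm{Conf}_{n+1}(G)$ with $\phi_{n+1}\circ s=\mathrm{id}_{\mathrm{Conf}_n(G)}$. Equivalently, there is no identifying function: no continuous map $f:\mathrm{Conf}_n(G)\to G$ satisfies $f(x)\ne x_i$ for all $x=(x_1,\dots,x_n)\in\mathrm{Conf}_n(G)$ and all $1\le i\le n$. -/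

import Mathlib

/-- The `n`-th ordered configuration space of `G`: injective `n`-tuples of points of `G`, with the
subspace topology of the product topology on `Fin n → G`. -/
abbrev Conf (n : ℕ) (G : Type*) : Type _ :=
  {x : Fin n → G // Function.Injective x}

/-- The forgetting map `(x₁, …, xₙ, xₙ₊₁) ↦ (x₁, …, xₙ)`. -/
def forget (n : ℕ) (G : Type*) (x : Conf (n + 1) G) : Conf n G :=
  ⟨fun i => x.1 i.castSucc, x.2.comp (Fin.castSucc_injective n)⟩

/-- A section of the forgetting map: a continuous right inverse. -/
def IsSection {n : ℕ} {G : Type*} [TopologicalSpace G] (s : Conf n G → Conf (n + 1) G) : Prop :=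
  Continuous s ∧ forget n G ∘ s = id

/-- An identifying function: a continuous map that avoids every token of each configuration. -/
def IsIdentifyingFunction {n : ℕ} {G : Type*} [TopologicalSpace G] (f : Conf n G → G) : Prop :=
  Continuous f ∧ ∀ (x : Conf n G) (i : Fin n), f x ≠ x.1 i

/-- `G`, with its given cell structure, is a graph: a finite connected (Hausdorff) CW complex
without cells of dimension greater than one. -/
structure IsFiniteGraph (G : Type*) [TopologicalSpace G]
    [Topology.CWComplex (Set.univ : Set G)] : Prop where
  t2 : T2Space G
  connected : ConnectedSpace G
  finite : Topology.CWComplex.Finite (Set.univ : Set G)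
  dim_le_one : ∀ m : ℕ, 1 < m → IsEmpty (Topology.CWComplex.cell (Set.univ : Set G) m)

/-- The Euler characteristic of a finite graph: the number of vertices minus the number of edges. -/
noncomputable def graphEulerChar (G : Type*) [TopologicalSpace G]
    [Topology.CWComplex (Set.univ : Set G)] : ℤ :=
  (Nat.card (Topology.CWComplex.cell (Set.univ : Set G) 0) : ℤ) -
    (Nat.card (Topology.CWComplex.cell (Set.univ : Set G) 1) : ℤ)

/-!
Let `F` be an identifying function on `Conf n G`, and choose a spanning tree of `G`; there are
`1 - χ` remaining edges. Let the tokens other than `m` occupy all of them. Cutting these edges at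
their outermost tokens leaves a tree, in which `m` moves freely. If the value of `F` is not trapped
between the outermost tokens of one edge, it stays in this tree, so `F` is a fixed-point-free map
as a function of the position of `m`. As a tree has one more vertex than edges, such a map points
outwards at exactly one of the ends at which the edges were cut, so that it lies between `m` and the
neighbouring token when `m` is close to that end. In either case `F` lies between two consecutive
tokens of one edge. This depends only on the two tokens, the edge and the direction, since the other
tokens can be parked elsewhere. With `n ≥ 2 - χ` tokens, all pairs among three tokens turn out to be
forced in this way on one common edge, so that two pairs `u, v` and `v, w` are forced in the same
direction. With `u`, `v`, `w` in consecutive positions, the value of `F` would then lie both between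
`u` and `v` and between `v` and `w`.
-/

open Set Filter Topology

/-- A topological space presented as a one-dimensional complex: the points `vertex v` together with
the open arcs `edge e '' Ioo 0 1` partition the space, and each `edge e` is a path on `[0, 1]`
joining `vertex (src e)` to `vertex (tgt e)`. -/
structure GraphModel (G : Type*) [TopologicalSpace G] (V E : Type*) where
  vertex : V → G
  edge : E → ℝ → G
  src : E → V
  tgt : E → V
  continuousOn_edge : ∀ e, ContinuousOn (edge e) (Icc 0 1)
  edge_zero : ∀ e, edge e 0 = vertex (src e)
  edge_one : ∀ e, edge e 1 = vertex (tgt e)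
  vertex_injective : Function.Injective vertex
  edge_inj : ∀ {e e' : E} {t t' : ℝ}, t ∈ Ioo (0 : ℝ) 1 → t' ∈ Ioo (0 : ℝ) 1 →
    edge e t = edge e' t' → e = e' ∧ t = t'
  edge_ne_vertex : ∀ {e : E} {t : ℝ} {v : V}, t ∈ Ioo (0 : ℝ) 1 → edge e t ≠ vertex v
  exists_eq : ∀ x, (∃ v, vertex v = x) ∨ ∃ e, ∃ t ∈ Ioo (0 : ℝ) 1, edge e t = x

namespace GraphModel

variable {G : Type*} [TopologicalSpace G] {V E : Type*}

lemma edge_mem_image_iff (M : GraphModel G V E) {e e' : E} {t : ℝ} {J : Set ℝ}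
    (ht : t ∈ Icc (0 : ℝ) 1) (hJ : J ⊆ Ioo 0 1) :
    M.edge e' t ∈ M.edge e '' J ↔ e' = e ∧ t ∈ J := by
  constructor
  · rintro ⟨u, hu, hut⟩
    rcases eq_or_lt_of_le ht.1 with h0 | h0
    · rw [← h0, M.edge_zero] at hut
      exact absurd hut (M.edge_ne_vertex (hJ hu))
    rcases eq_or_lt_of_le ht.2 with h1 | h1
    · rw [h1, M.edge_one] at hut
      exact absurd hut (M.edge_ne_vertex (hJ hu))
    obtain ⟨rfl, rfl⟩ := M.edge_inj (hJ hu) ⟨h0, h1⟩ hut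
    exact ⟨rfl, hu⟩
  · rintro ⟨rfl, h⟩
    exact ⟨t, h, rfl⟩

lemma isClosed_image_edge [T2Space G] (M : GraphModel G V E) (e : E) {s t : ℝ} (hs : 0 ≤ s)
    (ht : t ≤ 1) :
    IsClosed (M.edge e '' Icc s t) :=
  (isCompact_Icc.image_of_continuousOn
    ((M.continuousOn_edge e).mono (Icc_subset_Icc hs ht))).isClosed

section

variable [T2Space G] [Finite V] [Finite E]

lemma isClosed_of_forall_edge (M : GraphModel G V E) {Y : Set G}
    (h : ∀ e, IsClosed (Icc (0 : ℝ) 1 ∩ M.edge e ⁻¹' Y)) : IsClosed Y := by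
  have key : Y = (M.vertex '' (M.vertex ⁻¹' Y)) ∪
      ⋃ e, M.edge e '' (Icc (0 : ℝ) 1 ∩ M.edge e ⁻¹' Y) := by
    ext x
    simp only [mem_union, mem_iUnion, mem_image, mem_preimage, mem_inter_iff]
    constructor
    · intro hx
      rcases M.exists_eq x with ⟨v, rfl⟩ | ⟨e, t, ht, rfl⟩
      · exact Or.inl ⟨v, hx, rfl⟩
      · exact Or.inr ⟨e, t, ⟨Ioo_subset_Icc_self ht, hx⟩, rfl⟩
    · rintro (⟨v, hv, rfl⟩ | ⟨e, t, ⟨-, hx⟩, rfl⟩)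
      exacts [hv, hx]
  rw [key]
  refine IsClosed.union ((toFinite _).image _).isClosed (isClosed_iUnion_of_finite fun e => ?_)
  refine IsCompact.isClosed (IsCompact.image_of_continuousOn ?_
    ((M.continuousOn_edge e).mono inter_subset_left))
  exact isCompact_Icc.of_isClosed_subset (h e) inter_subset_left

lemma isOpen_image_edge (M : GraphModel G V E) (e : E) {J : Set ℝ} (hJo : IsOpen J)
    (hJ : J ⊆ Ioo 0 1) : IsOpen (M.edge e '' J) := by
  rw [← isClosed_compl_iff]
  refine M.isClosed_of_forall_edge fun e' => ?_
  have hpre : Icc (0 : ℝ) 1 ∩ M.edge e' ⁻¹' (M.edge e '' J)ᶜ = Icc 0 1 ∩ {t | e' = e → t ∉ J} := by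
    ext t
    simp only [mem_inter_iff, mem_preimage, mem_compl_iff, mem_ofPred_eq, and_congr_right_iff]
    intro ht
    rw [M.edge_mem_image_iff ht hJ, not_and]
  rw [hpre]
  by_cases he : e' = e
  · simp only [he, forall_const]
    exact isClosed_Icc.inter hJo.isClosed_compl
  · simp [he, isClosed_Icc]

lemma continuousOn_of_forall_edge (M : GraphModel G V E) {Y : Type*} [TopologicalSpace Y]
    {U : Set G} (hU : IsOpen U) {h : G → Y}
    (hh : ∀ e, ContinuousOn (fun t => h (M.edge e t)) (Icc (0 : ℝ) 1 ∩ M.edge e ⁻¹' U)) :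
    ContinuousOn h U := by
  rw [continuousOn_open_iff hU]
  intro O hO
  rw [← isClosed_compl_iff]
  refine M.isClosed_of_forall_edge fun e => ?_
  obtain ⟨A, hA, hAU⟩ := (continuousOn_iff'.1 (M.continuousOn_edge e)) U hU
  obtain ⟨B, hB, hBO⟩ := (continuousOn_iff'.1 (hh e)) O hO
  have : Icc (0 : ℝ) 1 ∩ M.edge e ⁻¹' (U ∩ h ⁻¹' O)ᶜ = Icc (0 : ℝ) 1 ∩ (A ∩ B)ᶜ := by
    ext t
    have h1 := Set.ext_iff.1 hAU t
    have h2 := Set.ext_iff.1 hBO t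
    simp only [mem_inter_iff, mem_preimage, mem_compl_iff] at h1 h2 ⊢
    tauto
  rw [this]
  exact isClosed_Icc.inter (hA.inter hB).isClosed_compl

end

variable {Y : Type*} [Inhabited Y]

open Classical in
/-- The function on `G` with value `a v` at the vertex `v` and `b e t` at the interior point of the
edge `e` with parameter `t`; the last branch of the definition is never reached. -/
noncomputable def lift (M : GraphModel G V E) (a : V → Y) (b : E → ℝ → Y) (x : G) : Y :=
  if h : ∃ v, M.vertex v = x then a h.choose
  else if h : ∃ e : E × ℝ, e.2 ∈ Ioo (0 : ℝ) 1 ∧ M.edge e.1 e.2 = x then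
    b h.choose.1 h.choose.2
  else default

lemma lift_vertex (M : GraphModel G V E) (a : V → Y) (b : E → ℝ → Y) (v : V) :
    M.lift a b (M.vertex v) = a v := by
  have h : ∃ v', M.vertex v' = M.vertex v := ⟨v, rfl⟩
  rw [lift, dif_pos h, M.vertex_injective h.choose_spec]

lemma lift_edge (M : GraphModel G V E) (a : V → Y) (b : E → ℝ → Y) (e : E) {t : ℝ}
    (ht : t ∈ Ioo (0 : ℝ) 1) : M.lift a b (M.edge e t) = b e t := by
  have h0 : ¬ ∃ v, M.vertex v = M.edge e t := fun ⟨v, hv⟩ => M.edge_ne_vertex ht hv.symm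
  have h : ∃ e' : E × ℝ, e'.2 ∈ Ioo (0 : ℝ) 1 ∧ M.edge e'.1 e'.2 = M.edge e t := ⟨(e, t), ht, rfl⟩
  rw [lift, dif_neg h0, dif_pos h]
  obtain ⟨h1, h2⟩ := M.edge_inj h.choose_spec.1 ht h.choose_spec.2
  rw [h1, h2]

lemma lift_edge_of_mem_Icc (M : GraphModel G V E) {a : V → Y} {b : E → ℝ → Y} {e : E}
    (h0 : b e 0 = a (M.src e)) (h1 : b e 1 = a (M.tgt e)) {t : ℝ} (ht : t ∈ Icc (0 : ℝ) 1) :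
    M.lift a b (M.edge e t) = b e t := by
  rcases eq_or_lt_of_le ht.1 with h | h
  · rw [← h, M.edge_zero, M.lift_vertex, h0]
  rcases eq_or_lt_of_le ht.2 with h' | h'
  · rw [h', M.edge_one, M.lift_vertex, h1]
  · exact M.lift_edge a b e ⟨h, h'⟩

lemma continuousOn_lift [TopologicalSpace Y] [T2Space G] [Finite V] [Finite E]
    (M : GraphModel G V E) {a : V → Y} {b : E → ℝ → Y}
    {U : Set G} (hU : IsOpen U) (h0 : ∀ e, b e 0 = a (M.src e))
    (h1 : ∀ e, b e 1 = a (M.tgt e))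
    (hb : ∀ e, ContinuousOn (b e) (Icc (0 : ℝ) 1 ∩ M.edge e ⁻¹' U)) :
    ContinuousOn (M.lift a b) U :=
  M.continuousOn_of_forall_edge hU fun e =>
    (hb e).congr fun _ ht => M.lift_edge_of_mem_Icc (h0 e) (h1 e) ht.1

end GraphModel

section Ancestors

variable {M : Type*}

/-- One step from a non-root vertex to its parent. -/
def ParentStep (par : M → Option M) (u w : Option M) : Prop := ∃ v, u = some v ∧ w = par v

/-- `w` is an ancestor of `u`, or `u` itself. -/
def IsAncestor (par : M → Option M) (w u : Option M) : Prop :=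
  Relation.ReflTransGen (ParentStep par) u w

variable {par : M → Option M} {d : Option M → ℕ}

lemma IsAncestor.refl (w : Option M) : IsAncestor par w w := Relation.ReflTransGen.refl

lemma isAncestor_parent {v : M} : IsAncestor par (par v) (some v) :=
  Relation.ReflTransGen.single ⟨v, rfl, rfl⟩

lemma IsAncestor.trans {u v w : Option M} (h : IsAncestor par u v) (h' : IsAncestor par v w) :
    IsAncestor par u w := Relation.ReflTransGen.trans h' h

lemma IsAncestor.depth_le (hd : ∀ v, d (par v) < d (some v)) {u w : Option M}
    (h : IsAncestor par w u) : d w ≤ d u := by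
  induction h with
  | refl => exact le_rfl
  | tail _ h ih =>
    obtain ⟨v, rfl, rfl⟩ := h
    exact (hd v).le.trans ih

lemma isAncestor_none (hd : ∀ v, d (par v) < d (some v)) (u : Option M) :
    IsAncestor par none u := by
  induction h : d u using Nat.strong_induction_on generalizing u with
  | _ k ih =>
    cases u with
    | none => exact IsAncestor.refl _
    | some v => exact (ih _ (h ▸ hd v) _ rfl).trans isAncestor_parent

lemma isAncestor_some_iff {w : Option M} {v : M} (hw : w ≠ some v) :
    IsAncestor par w (some v) ↔ IsAncestor par w (par v) := by
  refine ⟨fun h => ?_, fun h => h.trans isAncestor_parent⟩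
  rcases Relation.ReflTransGen.cases_head h with h | ⟨c, ⟨v', hv', rfl⟩, h⟩
  · exact absurd h.symm hw
  · obtain rfl := Option.some.inj hv'
    exact h

lemma not_isAncestor_parent (hd : ∀ v, d (par v) < d (some v)) (v : M) :
    ¬ IsAncestor par (some v) (par v) :=
  fun h => absurd (h.depth_le hd) (not_le.2 (hd v))

lemma IsAncestor.total {u v w : Option M} (hu : IsAncestor par u w) (hv : IsAncestor par v w) :
    IsAncestor par v u ∨ IsAncestor par u v := by
  refine Relation.ReflTransGen.total_of_right_unique ?_ hu hv
  rintro _ _ _ ⟨a, rfl, rfl⟩ ⟨b, hb, rfl⟩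
  rw [Option.some.inj hb]

open Classical in
/-- The indicator of the descendants of `v`: equal to `1` at `v` and at the vertices beyond it as
seen from the root, and to `0` elsewhere. -/
noncomputable def descendantIndicator (par : M → Option M) (v : M) (w : Option M) : ℝ :=
  if IsAncestor par (some v) w then 1 else 0

lemma descendantIndicator_mem_Icc (v : M) (w : Option M) :
    descendantIndicator par v w ∈ Icc (0 : ℝ) 1 := by
  unfold descendantIndicator
  split_ifs <;> simp

lemma descendantIndicator_notMem_Ioo (v : M) (w : Option M) :
    descendantIndicator par v w ∉ Ioo (0 : ℝ) 1 := by
  unfold descendantIndicator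
  split_ifs <;> simp

lemma descendantIndicator_pos_iff {v : M} {w : Option M} :
    0 < descendantIndicator par v w ↔ IsAncestor par (some v) w := by
  unfold descendantIndicator
  split_ifs with h <;> simp [h]

lemma descendantIndicator_lt_one_iff {v : M} {w : Option M} :
    descendantIndicator par v w < 1 ↔ ¬ IsAncestor par (some v) w := by
  unfold descendantIndicator
  split_ifs with h <;> simp [h]

lemma descendantIndicator_self (v : M) : descendantIndicator par v (some v) = 1 :=
  if_pos (IsAncestor.refl _)

lemma descendantIndicator_parent (hd : ∀ v, d (par v) < d (some v)) (v : M) :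
    descendantIndicator par v (par v) = 0 :=
  if_neg (not_isAncestor_parent hd v)

open Classical in
lemma descendantIndicator_some_of_ne {v v' : M} (h : v ≠ v') :
    descendantIndicator par v (some v') = descendantIndicator par v (par v') :=
  if_congr (isAncestor_some_iff (by simpa using h)) rfl rfl

lemma existsUnique_edge_towards_vertex (hd : ∀ v, d (par v) < d (some v)) {u w : Option M}
    (huw : u ≠ w) : ∃! v : M, (some v = w ∧ descendantIndicator par v u < 1) ∨
      (par v = w ∧ 0 < descendantIndicator par v u) := by
  simp only [descendantIndicator_pos_iff, descendantIndicator_lt_one_iff]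
  by_cases hwu : IsAncestor par w u
  · rcases Relation.ReflTransGen.cases_tail hwu with h | ⟨c, hc, ⟨v, rfl, rfl⟩⟩
    · exact absurd h.symm huw
    refine ⟨v, Or.inr ⟨rfl, hc⟩, ?_⟩
    rintro v' (⟨h1, h2⟩ | ⟨h1, h2⟩)
    · rw [h1] at h2
      exact absurd hwu h2
    · by_contra hne
      rcases IsAncestor.total hc h2 with h | h
      · rw [isAncestor_some_iff (by simpa using hne), ← h1] at h
        exact not_isAncestor_parent hd _ h
      · rw [isAncestor_some_iff (by simpa using Ne.symm hne), h1] at h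
        exact not_isAncestor_parent hd _ h
  · cases w with
    | none => exact absurd (isAncestor_none hd u) hwu
    | some v =>
      refine ⟨v, Or.inl ⟨rfl, hwu⟩, ?_⟩
      rintro v' (⟨h1, -⟩ | ⟨h1, h2⟩)
      · exact Option.some.inj h1
      · refine absurd (IsAncestor.trans ?_ h2) hwu
        rw [← h1]
        exact isAncestor_parent

end Ancestors

section EdgeDirection

variable {X : Type*} [TopologicalSpace X]

/-- A continuous self-map of the subset `s` without fixed points, given by a function that may take
arbitrary values outside `s`. -/
structure FixedPointFreeOn (g : X → X) (s : Set X) : Prop where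
  continuousOn : ContinuousOn g s
  mapsTo : MapsTo g s s
  ne : ∀ x ∈ s, g x ≠ x

variable {T : Set X} {g : X → X} {h : X → ℝ} {α : ℝ → X}

lemma FixedPointFreeOn.forall_lt_or_forall_gt (hg : FixedPointFreeOn g T)
    (hh : ContinuousOn h T) (hα : ContinuousOn α (Ioo 0 1)) (hαT : MapsTo α (Ioo 0 1) T)
    (hcoord : ∀ x ∈ T, h x ∈ Ioo (0 : ℝ) 1 → α (h x) = x) :
    (∀ t ∈ Ioo (0 : ℝ) 1, t < h (g (α t))) ∨ ∀ t ∈ Ioo (0 : ℝ) 1, h (g (α t)) < t := by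
  have hc : ContinuousOn (fun t => h (g (α t))) (Ioo 0 1) :=
    hh.comp (hg.continuousOn.comp hα hαT) (hg.mapsTo.comp hαT)
  have hne : ∀ t ∈ Ioo (0 : ℝ) 1, h (g (α t)) ≠ t := by
    intro t ht heq
    have hgt := hcoord _ (hg.mapsTo (hαT ht)) (heq.symm ▸ ht)
    rw [heq] at hgt
    exact hg.ne _ (hαT ht) hgt.symm
  by_contra! hcon
  obtain ⟨⟨a, ha, ha'⟩, b, hb, hb'⟩ := hcon
  obtain ⟨c, hc1, hc2⟩ := isPreconnected_Ioo.intermediate_value₂ ha hb hc continuousOn_id ha' hb'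
  exact hne c hc1 hc2

-- If `h (g (α 0)) = 0` although `g` points forward, then `g (α t) = α (h (g (α t)))` tends to `α 0`
-- as `t` tends to `0`, so that `α 0` is a fixed point.
lemma FixedPointFreeOn.pos_of_forall_lt [T2Space X] (hg : FixedPointFreeOn g T)
    (hh : ContinuousOn h T) (hα : ContinuousOn α (Ico 0 1)) (hαT : MapsTo α (Ico 0 1) T)
    (hcoord : ∀ x ∈ T, h x ∈ Ioo (0 : ℝ) 1 → α (h x) = x) (hnonneg : ∀ x ∈ T, 0 ≤ h x)
    (hlt : ∀ t ∈ Ioo (0 : ℝ) 1, t < h (g (α t))) : 0 < h (g (α 0)) := by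
  have h0 : (0 : ℝ) ∈ Ico (0 : ℝ) 1 := by simp
  have hle : 𝓝[Ioo 0 1] (0 : ℝ) ≤ 𝓝[Ico 0 1] 0 := nhdsWithin_mono _ Ioo_subset_Ico_self
  have hgα : ContinuousOn (fun t => g (α t)) (Ico 0 1) := hg.continuousOn.comp hα hαT
  have hc : Tendsto (fun t => h (g (α t))) (𝓝[Ioo 0 1] 0) (𝓝 (h (g (α 0)))) :=
    (hh.comp hgα (hg.mapsTo.comp hαT) 0 h0).mono_left hle
  have : (𝓝[Ioo 0 1] (0 : ℝ)).NeBot := by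
    rw [nhdsWithin_Ioo_eq_nhdsGT zero_lt_one]
    infer_instance
  refine lt_of_le_of_ne (hnonneg _ (hg.mapsTo (hαT h0))) fun heq => ?_
  rw [← heq] at hc
  have hmem : ∀ᶠ t in 𝓝[Ioo 0 1] (0 : ℝ), h (g (α t)) ∈ Ioo (0 : ℝ) 1 := by
    filter_upwards [self_mem_nhdsWithin, hc.eventually_lt_const zero_lt_one] with t ht ht1
    exact ⟨ht.1.trans (hlt t ht), ht1⟩
  have hα0 : Tendsto (fun t => α (h (g (α t)))) (𝓝[Ioo 0 1] 0) (𝓝 (α 0)) :=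
    (hα 0 h0).tendsto.comp (tendsto_nhdsWithin_iff.2
      ⟨hc, hmem.mono fun t ht => Ioo_subset_Ico_self ht⟩)
  have hgα0 : Tendsto (fun t => g (α t)) (𝓝[Ioo 0 1] 0) (𝓝 (g (α 0))) :=
    (hgα 0 h0).mono_left hle
  have heq : (fun t => α (h (g (α t)))) =ᶠ[𝓝[Ioo 0 1] 0] fun t => g (α t) := by
    filter_upwards [self_mem_nhdsWithin, hmem] with t ht htm
    exact hcoord _ (hg.mapsTo (hαT (Ioo_subset_Ico_self ht))) htm
  exact hg.ne _ (hαT h0) (tendsto_nhds_unique hgα0 (hα0.congr' heq))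

lemma FixedPointFreeOn.pos_iff_forall_lt [T2Space X] (hg : FixedPointFreeOn g T)
    (hh : ContinuousOn h T) (hα : ContinuousOn α (Ico 0 1)) (hαT : MapsTo α (Ico 0 1) T)
    (hcoord : ∀ x ∈ T, h x ∈ Ioo (0 : ℝ) 1 → α (h x) = x) (hnonneg : ∀ x ∈ T, 0 ≤ h x) :
    0 < h (g (α 0)) ↔ ∀ t ∈ Ioo (0 : ℝ) 1, t < h (g (α t)) := by
  refine ⟨fun hpos => ?_, hg.pos_of_forall_lt hh hα hαT hcoord hnonneg⟩
  refine (hg.forall_lt_or_forall_gt hh (hα.mono Ioo_subset_Ico_self)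
    (hαT.mono_left Ioo_subset_Ico_self) hcoord).resolve_right fun hlt => hpos.not_ge ?_
  have hIoo : Ioo (0 : ℝ) 1 ∈ 𝓝[>] (0 : ℝ) := Ioo_mem_nhdsGT zero_lt_one
  have hc : Tendsto (fun t => h (g (α t))) (𝓝[>] 0) (𝓝 (h (g (α 0)))) := by
    rw [← nhdsWithin_Ioo_eq_nhdsGT (zero_lt_one : (0 : ℝ) < 1)]
    exact (hh.comp (hg.continuousOn.comp hα hαT) (hg.mapsTo.comp hαT) 0
      (left_mem_Ico.2 zero_lt_one)).mono_left (nhdsWithin_mono _ Ioo_subset_Ico_self)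
  exact le_of_tendsto_of_tendsto hc (tendsto_id.mono_left nhdsWithin_le_nhds)
    (by filter_upwards [hIoo] with t ht using (hlt t ht).le)

lemma FixedPointFreeOn.lt_one_iff_forall_gt [T2Space X] (hg : FixedPointFreeOn g T)
    (hh : ContinuousOn h T) (hα : ContinuousOn α (Ioc 0 1)) (hαT : MapsTo α (Ioc 0 1) T)
    (hcoord : ∀ x ∈ T, h x ∈ Ioo (0 : ℝ) 1 → α (h x) = x) (hle : ∀ x ∈ T, h x ≤ 1) :
    h (g (α 1)) < 1 ↔ ∀ t ∈ Ioo (0 : ℝ) 1, h (g (α t)) < t := by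
  have hmap : MapsTo (fun t : ℝ => 1 - t) (Ico 0 1) (Ioc 0 1) := fun t ht =>
    ⟨by linarith [ht.2], by linarith [ht.1]⟩
  have hflip : ∀ t ∈ Ioo (0 : ℝ) 1, 1 - t ∈ Ioo (0 : ℝ) 1 := fun t ht =>
    ⟨by linarith [ht.2], by linarith [ht.1]⟩
  have key := hg.pos_iff_forall_lt (α := fun t => α (1 - t)) (h := fun x => 1 - h x)
    (continuousOn_const.sub hh) (hα.comp (by fun_prop) hmap) (hαT.comp hmap)
    (fun x hx hx' => by simpa using hcoord x hx (by simpa using hflip _ hx'))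
    (fun x hx => by linarith [hle x hx])
  simp only [sub_zero, sub_pos] at key
  rw [key]
  refine ⟨fun H t ht => ?_, fun H t ht => ?_⟩
  · have := H (1 - t) (hflip t ht)
    rw [sub_sub_cancel] at this
    linarith
  · linarith [H (1 - t) (hflip t ht)]

end EdgeDirection

/-- A rooted tree `carrier` inside `X`, some of whose leaves have been removed. The root is `none`,
the edge `edge m` runs from the vertex `parent m` to the vertex `some m`, and the removed leaves are
the vertices `some l` with `l ∈ ends`. The function `coord m` is the coordinate along the edge `m`,
extended by `0` and `1` to the two sides of that edge. -/
structure OpenTree (X M : Type*) [TopologicalSpace X] where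
  parent : M → Option M
  depth : Option M → ℕ
  depth_parent_lt : ∀ m, depth (parent m) < depth (some m)
  ends : Set M
  parent_notMem : ∀ m, parent m ∉ some '' ends
  carrier : Set X
  vertex : Option M → X
  edge : M → ℝ → X
  coord : M → X → ℝ
  vertex_mem : ∀ w ∉ some '' ends, vertex w ∈ carrier
  edge_mem : ∀ m, MapsTo (edge m) (Ioo 0 1) carrier
  continuousOn_edge : ∀ m, ContinuousOn (edge m) (Icc 0 1)
  edge_zero : ∀ m, edge m 0 = vertex (parent m)
  edge_one : ∀ m, edge m 1 = vertex (some m)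
  exists_eq : ∀ x ∈ carrier, (∃ w ∉ some '' ends, vertex w = x) ∨
    ∃ m, ∃ t ∈ Ioo (0 : ℝ) 1, edge m t = x
  continuousOn_coord : ∀ m, ContinuousOn (coord m) carrier
  coord_vertex : ∀ m, ∀ w ∉ some '' ends, coord m (vertex w) = descendantIndicator parent m w
  coord_edge_self : ∀ m, ∀ t ∈ Ioo (0 : ℝ) 1, coord m (edge m t) = t
  coord_edge_of_ne : ∀ m m', m ≠ m' → ∀ t ∈ Ioo (0 : ℝ) 1,
    coord m (edge m' t) = descendantIndicator parent m (parent m')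

namespace OpenTree

variable {X M : Type*} [TopologicalSpace X] (T : OpenTree X M)

lemma edge_coord {m : M} {x : X} (hx : x ∈ T.carrier) (hmx : T.coord m x ∈ Ioo (0 : ℝ) 1) :
    T.edge m (T.coord m x) = x := by
  rcases T.exists_eq x hx with ⟨w, hw, rfl⟩ | ⟨m', t, ht, rfl⟩
  · rw [T.coord_vertex m w hw] at hmx
    exact absurd hmx (descendantIndicator_notMem_Ioo m w)
  · by_cases h : m = m'
    · rw [← h, T.coord_edge_self m t ht]
    · rw [T.coord_edge_of_ne m m' h t ht] at hmx
      exact absurd hmx (descendantIndicator_notMem_Ioo m _)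

lemma coord_mem_Icc (m : M) {x : X} (hx : x ∈ T.carrier) : T.coord m x ∈ Icc (0 : ℝ) 1 := by
  rcases T.exists_eq x hx with ⟨w, hw, rfl⟩ | ⟨m', t, ht, rfl⟩
  · rw [T.coord_vertex m w hw]
    exact descendantIndicator_mem_Icc m w
  · by_cases h : m = m'
    · rw [← h, T.coord_edge_self m t ht]
      exact Ioo_subset_Icc_self ht
    · rw [T.coord_edge_of_ne m m' h t ht]
      exact descendantIndicator_mem_Icc m _

lemma not_isAncestor_end {l : M} (hl : l ∈ T.ends) {w : Option M} (hw : w ∉ some '' T.ends) :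
    ¬ IsAncestor T.parent (some l) w := by
  intro h
  rcases Relation.ReflTransGen.cases_tail h with h | ⟨_, -, m, -, hm⟩
  · exact hw ⟨l, hl, h⟩
  · exact T.parent_notMem m ⟨l, hl, hm⟩

lemma coord_end_lt_one {l : M} (hl : l ∈ T.ends) {x : X} (hx : x ∈ T.carrier) :
    T.coord l x < 1 := by
  rcases T.exists_eq x hx with ⟨w, hw, rfl⟩ | ⟨m', t, ht, rfl⟩
  · rw [T.coord_vertex l w hw, descendantIndicator_lt_one_iff]
    exact T.not_isAncestor_end hl hw
  · by_cases h : l = m'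
    · rw [← h, T.coord_edge_self l t ht]
      exact ht.2
    · rw [T.coord_edge_of_ne l m' h t ht, descendantIndicator_lt_one_iff]
      exact T.not_isAncestor_end hl (T.parent_notMem m')

lemma edge_mem_of_mem_Ico (m : M) {t : ℝ} (ht : t ∈ Ico (0 : ℝ) 1) : T.edge m t ∈ T.carrier := by
  rcases eq_or_lt_of_le ht.1 with rfl | h
  · rw [T.edge_zero]
    exact T.vertex_mem _ (T.parent_notMem m)
  · exact T.edge_mem m ⟨h, ht.2⟩

lemma edge_mem_of_mem_Ioc {m : M} (hm : m ∉ T.ends) {t : ℝ} (ht : t ∈ Ioc (0 : ℝ) 1) :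
    T.edge m t ∈ T.carrier := by
  rcases eq_or_lt_of_le ht.2 with rfl | h
  · rw [T.edge_one]
    exact T.vertex_mem _ (by simpa using hm)
  · exact T.edge_mem m ⟨ht.1, h⟩

lemma existsUnique_edge_towards {w : Option M} {x : X} (hx : x ∈ T.carrier)
    (hne : x ≠ T.vertex w) :
    ∃! m, (some m = w ∧ T.coord m x < 1) ∨ (T.parent m = w ∧ 0 < T.coord m x) := by
  rcases T.exists_eq x hx with ⟨u, hu, rfl⟩ | ⟨m', t, ht, rfl⟩
  · simp only [T.coord_vertex _ u hu]
    exact existsUnique_edge_towards_vertex T.depth_parent_lt fun h => hne (by rw [h])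
  · by_cases hw : some m' = w
    · have huw : T.parent m' ≠ w := fun h =>
        (T.depth_parent_lt m').ne (congrArg T.depth (h.trans hw.symm))
      refine (existsUnique_congr fun m => ?_).2
        (existsUnique_edge_towards_vertex T.depth_parent_lt huw)
      by_cases hm : m = m'
      · subst hm
        rw [T.coord_edge_self m t ht, descendantIndicator_parent T.depth_parent_lt]
        simp [hw, huw, ht.2]
      · rw [T.coord_edge_of_ne m m' hm t ht]
    · refine (existsUnique_congr fun m => ?_).2
        (existsUnique_edge_towards_vertex T.depth_parent_lt hw)
      by_cases hm : m = m'
      · subst hm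
        rw [T.coord_edge_self m t ht, descendantIndicator_self]
        simp [hw, ht.1]
      · rw [T.coord_edge_of_ne m m' hm t ht, descendantIndicator_some_of_ne hm]

/-- The self-map `g` moves each point of the edge `m` to the side of it away from the root. -/
def PointsForward (g : X → X) (m : M) : Prop :=
  ∀ t ∈ Ioo (0 : ℝ) 1, t < T.coord m (g (T.edge m t))

/-- The self-map `g` moves each point of the edge `m` to the side of it that contains the root. -/
def PointsBackward (g : X → X) (m : M) : Prop :=
  ∀ t ∈ Ioo (0 : ℝ) 1, T.coord m (g (T.edge m t)) < t

/-- The edge `m` is incident to the vertex `w`, and `g` moves its points away from `w`. -/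
def PointsAway (g : X → X) (w : Option M) (m : M) : Prop :=
  (some m = w ∧ T.PointsBackward g m) ∨ (T.parent m = w ∧ T.PointsForward g m)

variable {T} {g : X → X}

lemma PointsForward.not_pointsBackward {m : M} (h : T.PointsForward g m) :
    ¬ T.PointsBackward g m := fun h' =>
  have hhalf : (1 / 2 : ℝ) ∈ Ioo (0 : ℝ) 1 := by norm_num
  (h _ hhalf).asymm (h' _ hhalf)

lemma pointsForward_end_iff (hg : FixedPointFreeOn g T.carrier) {l : M} (hl : l ∈ T.ends) :
    T.PointsForward g l ↔
      ∀ t ∈ Ioo (0 : ℝ) 1, ∃ u ∈ Ioo t 1, g (T.edge l t) = T.edge l u := by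
  refine forall₂_congr fun t ht => ⟨fun h => ?_, ?_⟩
  · have hgt := hg.mapsTo (T.edge_mem l ht)
    have hlt := T.coord_end_lt_one hl hgt
    exact ⟨_, ⟨h, hlt⟩, (T.edge_coord hgt ⟨ht.1.trans h, hlt⟩).symm⟩
  · rintro ⟨u, hu, hgu⟩
    rw [hgu, T.coord_edge_self l u ⟨ht.1.trans hu.1, hu.2⟩]
    exact hu.1

lemma pointsForward_or_pointsBackward (hg : FixedPointFreeOn g T.carrier) (m : M) :
    T.PointsForward g m ∨ T.PointsBackward g m :=
  hg.forall_lt_or_forall_gt (T.continuousOn_coord m)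
    ((T.continuousOn_edge m).mono Ioo_subset_Icc_self) (T.edge_mem m) fun _ => T.edge_coord

lemma PointsAway.vertex_unique {w w' : Option M} {m : M} (h : T.PointsAway g w m)
    (h' : T.PointsAway g w' m) : w = w' := by
  rcases h with ⟨hw, hb⟩ | ⟨hw, hf⟩ <;> rcases h' with ⟨hw', hb'⟩ | ⟨hw', hf'⟩
  · exact hw.symm.trans hw'
  · exact absurd hb hf'.not_pointsBackward
  · exact absurd hb' hf.not_pointsBackward
  · exact hw.symm.trans hw'

lemma exists_pointsAway_iff (hg : FixedPointFreeOn g T.carrier) {m : M} :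
    (∃ w ∉ some '' T.ends, T.PointsAway g w m) ↔
      m ∉ T.ends ∨ m ∈ T.ends ∧ T.PointsForward g m := by
  constructor
  · rintro ⟨w, hw, ⟨rfl, -⟩ | ⟨-, hf⟩⟩
    · exact Or.inl fun hm => hw ⟨m, hm, rfl⟩
    · exact (em (m ∈ T.ends)).symm.imp_right fun hm => ⟨hm, hf⟩
  · intro hm
    rcases pointsForward_or_pointsBackward hg m with hf | hb
    · exact ⟨T.parent m, T.parent_notMem m, Or.inr ⟨rfl, hf⟩⟩
    · have hm' : m ∉ T.ends := hm.resolve_right fun h => h.2.not_pointsBackward hb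
      exact ⟨some m, by simpa using hm', Or.inl ⟨rfl, hb⟩⟩

variable [T2Space X]

lemma coord_pos_iff_pointsForward (hg : FixedPointFreeOn g T.carrier) (m : M) :
    0 < T.coord m (g (T.vertex (T.parent m))) ↔ T.PointsForward g m := by
  rw [← T.edge_zero]
  exact hg.pos_iff_forall_lt (T.continuousOn_coord m)
    ((T.continuousOn_edge m).mono Ico_subset_Icc_self) (fun _ => T.edge_mem_of_mem_Ico m)
    (fun _ => T.edge_coord) fun x hx => (T.coord_mem_Icc m hx).1

lemma coord_lt_one_iff_pointsBackward (hg : FixedPointFreeOn g T.carrier) {m : M}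
    (hm : m ∉ T.ends) : T.coord m (g (T.vertex (some m))) < 1 ↔ T.PointsBackward g m := by
  rw [← T.edge_one]
  exact hg.lt_one_iff_forall_gt (T.continuousOn_coord m)
    ((T.continuousOn_edge m).mono Ioc_subset_Icc_self) (fun _ => T.edge_mem_of_mem_Ioc hm)
    (fun _ => T.edge_coord) fun x hx => (T.coord_mem_Icc m hx).2

lemma existsUnique_pointsAway (hg : FixedPointFreeOn g T.carrier) {w : Option M}
    (hw : w ∉ some '' T.ends) : ∃! m, T.PointsAway g w m := by
  have hx := T.vertex_mem w hw
  refine (existsUnique_congr fun m => or_congr (and_congr_right ?_) (and_congr_right ?_)).1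
    (T.existsUnique_edge_towards (hg.mapsTo hx) (hg.ne _ hx))
  · rintro rfl
    exact coord_lt_one_iff_pointsBackward hg (by simpa using hw)
  · rintro rfl
    exact coord_pos_iff_pointsForward hg m

-- Sending a vertex to the edge along which the map moves it is injective, and its image consists of
-- all edges with two endpoints and of the ends along which the map points outwards. Since there is
-- one more vertex than there are edges with two endpoints, there is exactly one such end.
lemma existsUnique_end_pointsForward [Finite M] (hg : FixedPointFreeOn g T.carrier) :
    ∃! l, l ∈ T.ends ∧ T.PointsForward g l := by
  choose φ hφ hφ_unique using fun w : ↥(some '' T.ends)ᶜ => existsUnique_pointsAway hg w.2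
  have hφ_injective : Function.Injective φ := fun w w' h =>
    Subtype.ext ((hφ w).vertex_unique (h ▸ hφ w'))
  have hφ_range : range φ = T.endsᶜ ∪ {l | l ∈ T.ends ∧ T.PointsForward g l} := by
    ext m
    have hm := exists_pointsAway_iff hg (m := m)
    constructor
    · rintro ⟨w, rfl⟩
      exact hm.1 ⟨w, w.2, hφ w⟩
    · intro h
      obtain ⟨w, hw, hwm⟩ := hm.2 h
      exact ⟨⟨w, hw⟩, (hφ_unique ⟨w, hw⟩ m hwm).symm⟩
  have hdisj : Disjoint T.endsᶜ {l | l ∈ T.ends ∧ T.PointsForward g l} :=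
    disjoint_compl_left.mono_right fun _ h => h.1
  have hcard := ncard_union_eq hdisj
  rw [← hφ_range, ← Nat.card_coe_set_eq, Nat.card_range_of_injective hφ_injective,
    Nat.card_coe_set_eq] at hcard
  have hnodes := ncard_add_ncard_compl (some '' T.ends)
  have hedges := ncard_add_ncard_compl T.ends
  rw [ncard_image_of_injective _ (Option.some_injective M), Finite.card_option] at hnodes
  obtain ⟨l, hl⟩ := ncard_eq_one.1 (show {l | l ∈ T.ends ∧ T.PointsForward g l}.ncard = 1 by lia)
  exact ⟨l, hl.ge rfl, fun l' hl' => hl.le hl'⟩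

end OpenTree

/-- The distance of the parameter `x` from the initial (`true`) or terminal (`false`) end of an
edge. -/
def endDist (σ : Bool) (x : ℝ) : ℝ := if σ then x else 1 - x

lemma endDist_true (x : ℝ) : endDist true x = x := rfl

lemma endDist_false (x : ℝ) : endDist false x = 1 - x := rfl

lemma endDist_endDist (σ : Bool) (x : ℝ) : endDist σ (endDist σ x) = x := by
  cases σ <;> simp [endDist]

lemma endDist_injective (σ : Bool) : Function.Injective (endDist σ) :=
  Function.LeftInverse.injective (endDist_endDist σ)

@[fun_prop]
lemma continuous_endDist (σ : Bool) : Continuous (endDist σ) := by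
  cases σ
  · exact continuous_const.sub continuous_id
  · exact continuous_id

lemma endDist_mem_Icc {σ : Bool} {x : ℝ} (hx : x ∈ Icc (0 : ℝ) 1) :
    endDist σ x ∈ Icc (0 : ℝ) 1 := by
  cases σ
  · exact ⟨sub_nonneg.2 hx.2, sub_le_self _ hx.1⟩
  · exact hx

lemma endDist_mem_Ioo {σ : Bool} {x : ℝ} (hx : x ∈ Ioo (0 : ℝ) 1) :
    endDist σ x ∈ Ioo (0 : ℝ) 1 := by
  cases σ
  · exact ⟨sub_pos.2 hx.2, sub_lt_self _ hx.1⟩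
  · exact hx

namespace GraphModel

variable {G : Type*} [TopologicalSpace G] {V E : Type*} (M : GraphModel G V E)

/-- The initial (`true`) or terminal (`false`) vertex of an edge. -/
def endpoint (e : E) (σ : Bool) : V := if σ then M.src e else M.tgt e

lemma edge_endDist_zero (e : E) (σ : Bool) :
    M.edge e (endDist σ 0) = M.vertex (M.endpoint e σ) := by
  cases σ
  · simp [endpoint, endDist_false, M.edge_one]
  · simp [endpoint, endDist_true, M.edge_zero]

end GraphModel

/-- A graph model with a chosen rooted spanning tree. The root is `none`; the tree edge `Sum.inl v`
runs from the parent of `v` to `v`, and the remaining edges are indexed by `S`. -/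
structure RootedGraph (G : Type*) [TopologicalSpace G] (N S : Type*) extends
    GraphModel G (Option N) (N ⊕ S) where
  tgt_inl : ∀ v, tgt (Sum.inl v) = some v
  depth : Option N → ℕ
  depth_src_lt : ∀ v, depth (src (Sum.inl v)) < depth (some v)

namespace RootedGraph

variable {G : Type*} [TopologicalSpace G] {N S : Type*} (R : RootedGraph G N S)

/-- The vertex at the end `l.2` of the non-tree edge `l.1`. -/
def base (l : S × Bool) : Option N :=
  R.endpoint (Sum.inr l.1) l.2

/-- The non-tree edge `l.1`, parametrized by the distance from its end `l.2`. -/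
def ray (l : S × Bool) (t : ℝ) : G := R.edge (Sum.inr l.1) (endDist l.2 t)

lemma ray_endDist (l : S × Bool) (t : ℝ) :
    R.ray l (endDist l.2 t) = R.edge (Sum.inr l.1) t := by
  rw [ray, endDist_endDist]

lemma ray_zero (l : S × Bool) : R.ray l 0 = R.vertex (R.base l) :=
  R.edge_endDist_zero _ _

lemma continuousOn_ray (l : S × Bool) : ContinuousOn (R.ray l) (Icc 0 1) :=
  (R.continuousOn_edge _).comp (by fun_prop) fun _ ht => endDist_mem_Icc ht

end RootedGraph

/-- Every non-tree edge `i` is cut at the distances `r (i, true)` and `r (i, false)` from its two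
ends, which leaves a possibly degenerate closed arc between the two cuts. -/
structure IsCutDepth {S : Type*} (r : S × Bool → ℝ) : Prop where
  pos : ∀ l, 0 < r l
  add_le_one : ∀ i, r (i, true) + r (i, false) ≤ 1

namespace IsCutDepth

variable {S : Type*} {r : S × Bool → ℝ} (hr : IsCutDepth r)

include hr

lemma lt_one (l : S × Bool) : r l < 1 := by
  obtain ⟨i, _ | _⟩ := l <;> linarith [hr.pos (i, true), hr.pos (i, false), hr.add_le_one i]

lemma arc_subset_Ioo (i : S) : Icc (r (i, true)) (1 - r (i, false)) ⊆ Ioo 0 1 := fun _ ht =>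
  ⟨(hr.pos _).trans_le ht.1, ht.2.trans_lt (sub_lt_self _ (hr.pos _))⟩

lemma decide_lt_eq {l : S × Bool} {t : ℝ} (ht : endDist l.2 t < r l) :
    decide (t < r (l.1, true)) = l.2 := by
  obtain ⟨i, _ | _⟩ := l
  · rw [endDist_false] at ht
    exact decide_eq_false (by linarith [hr.add_le_one i])
  · exact decide_eq_true ht

lemma mul_mem_Ioo (l : S × Bool) {t : ℝ} (ht : t ∈ Ioo (0 : ℝ) 1) : t * r l ∈ Ioo 0 (r l) :=
  ⟨mul_pos ht.1 (hr.pos l), mul_lt_of_lt_one_left (hr.pos l) ht.2⟩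

lemma div_mem_Ioo {l : S × Bool} {t : ℝ} (ht : t ∈ Ioo 0 (r l)) : t / r l ∈ Ioo (0 : ℝ) 1 :=
  ⟨div_pos ht.1 (hr.pos l), (div_lt_one (hr.pos l)).2 ht.2⟩

lemma Ioo_subset (l : S × Bool) : Ioo 0 (r l) ⊆ Ioo 0 1 :=
  Ioo_subset_Ioo_right (hr.lt_one l).le

end IsCutDepth

namespace RootedGraph

variable {G : Type*} [TopologicalSpace G] {N S : Type*} (R : RootedGraph G N S)
  {r : S × Bool → ℝ}

/-- The complement of the arcs between the two cuts of the non-tree edges. -/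
def cutTree (r : S × Bool → ℝ) : Set G :=
  {x | ∀ i, x ∉ R.edge (Sum.inr i) '' Icc (r (i, true)) (1 - r (i, false))}

lemma vertex_mem_cutTree (hr : IsCutDepth r) (w : Option N) : R.vertex w ∈ R.cutTree r := by
  rintro i ⟨t, ht, hv⟩
  exact R.edge_ne_vertex (hr.arc_subset_Ioo i ht) hv

lemma edge_inl_mem_cutTree (hr : IsCutDepth r) (v : N) {t : ℝ} (ht : t ∈ Icc (0 : ℝ) 1) :
    R.edge (Sum.inl v) t ∈ R.cutTree r := by
  intro i
  rw [R.edge_mem_image_iff ht (hr.arc_subset_Ioo i)]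
  simp

lemma edge_inr_mem_cutTree_iff (hr : IsCutDepth r) (i : S) {t : ℝ} (ht : t ∈ Icc (0 : ℝ) 1) :
    R.edge (Sum.inr i) t ∈ R.cutTree r ↔ ∃ σ, endDist σ t < r (i, σ) := by
  have hmem : R.edge (Sum.inr i) t ∈ R.cutTree r ↔ t ∉ Icc (r (i, true)) (1 - r (i, false)) := by
    refine ⟨fun h h' => h i ⟨t, h', rfl⟩, fun h j hj => ?_⟩
    obtain ⟨hij, htj⟩ := (R.edge_mem_image_iff ht (hr.arc_subset_Ioo j)).1 hj
    obtain rfl := Sum.inr.inj hij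
    exact h htj
  rw [hmem, Bool.exists_bool, endDist_false, endDist_true, mem_Icc, not_and_or, not_le, not_le,
    or_comm, sub_lt_comm]

lemma ray_mem_cutTree (hr : IsCutDepth r) (l : S × Bool) {t : ℝ} (ht : t ∈ Ico 0 (r l)) :
    R.ray l t ∈ R.cutTree r :=
  (R.edge_inr_mem_cutTree_iff hr l.1
    (endDist_mem_Icc ⟨ht.1, (ht.2.trans (hr.lt_one l)).le⟩)).2
    ⟨l.2, by rw [endDist_endDist]; exact ht.2⟩

lemma isOpen_cutTree [T2Space G] [Finite S] (hr : IsCutDepth r) : IsOpen (R.cutTree r) := by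
  have hcut : R.cutTree r =
      ⋂ i, (R.edge (Sum.inr i) '' Icc (r (i, true)) (1 - r (i, false)))ᶜ := by
    ext x
    simp [cutTree]
  rw [hcut]
  exact isOpen_iInter_of_finite fun i => (R.isClosed_image_edge _ (hr.pos _).le
    (sub_le_self _ (hr.pos _).le)).isOpen_compl

/-- The parent map of the cut tree, whose edges are the tree edges and one half-edge for each end
of a non-tree edge. -/
def cutParent : N ⊕ S × Bool → Option (N ⊕ S × Bool)
  | Sum.inl v => (R.src (Sum.inl v)).map Sum.inl
  | Sum.inr l => (R.base l).map Sum.inl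

/-- The depth function of the cut tree. -/
def cutDepth : Option (N ⊕ S × Bool) → ℕ
  | none => R.depth none
  | some (Sum.inl v) => R.depth (some v)
  | some (Sum.inr l) => R.depth (R.base l) + 1

lemma cutDepth_map_inl (w : Option N) : R.cutDepth (w.map Sum.inl) = R.depth w := by
  cases w <;> rfl

lemma cutDepth_cutParent_lt (m : N ⊕ S × Bool) :
    R.cutDepth (R.cutParent m) < R.cutDepth (some m) := by
  rcases m with v | l
  · exact (R.cutDepth_map_inl _).trans_lt (R.depth_src_lt v)
  · exact (R.cutDepth_map_inl _).trans_lt (Nat.lt_succ_self _)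

lemma map_inl_notMem_ends (w : Option N) :
    w.map Sum.inl ∉ some '' range (Sum.inr : S × Bool → N ⊕ S × Bool) := by
  cases w <;> simp

lemma exists_eq_map_inl {w : Option (N ⊕ S × Bool)}
    (hw : w ∉ some '' range (Sum.inr : S × Bool → N ⊕ S × Bool)) :
    ∃ u : Option N, w = u.map Sum.inl := by
  rcases w with _ | v | l
  · exact ⟨none, rfl⟩
  · exact ⟨some v, rfl⟩
  · exact absurd ⟨_, ⟨l, rfl⟩, rfl⟩ hw

/-- The vertices of the cut tree together with the points at which the edges are cut. -/
def cutVertex (r : S × Bool → ℝ) : Option (N ⊕ S × Bool) → G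
  | none => R.vertex none
  | some (Sum.inl v) => R.vertex (some v)
  | some (Sum.inr l) => R.ray l (r l)

lemma cutVertex_map_inl (w : Option N) : R.cutVertex r (w.map Sum.inl) = R.vertex w := by
  cases w <;> rfl

/-- The edges of the cut tree, parametrized by `[0, 1]` in the direction away from the root. -/
def cutEdge (r : S × Bool → ℝ) : N ⊕ S × Bool → ℝ → G
  | Sum.inl v, t => R.edge (Sum.inl v) t
  | Sum.inr l, t => R.ray l (t * r l)

lemma continuousOn_cutEdge (hr : IsCutDepth r) (m : N ⊕ S × Bool) :
    ContinuousOn (R.cutEdge r m) (Icc 0 1) := by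
  rcases m with v | l
  · exact R.continuousOn_edge _
  · exact (R.continuousOn_ray l).comp (by fun_prop) fun t ht =>
      ⟨mul_nonneg ht.1 (hr.pos l).le, mul_le_one₀ ht.2 (hr.pos l).le (hr.lt_one l).le⟩

lemma cutEdge_mem (hr : IsCutDepth r) (m : N ⊕ S × Bool) :
    MapsTo (R.cutEdge r m) (Ioo 0 1) (R.cutTree r) := by
  intro t ht
  rcases m with v | l
  · exact R.edge_inl_mem_cutTree hr v (Ioo_subset_Icc_self ht)
  · exact R.ray_mem_cutTree hr l (Ioo_subset_Ico_self (hr.mul_mem_Ioo l ht))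

lemma cutEdge_zero (m : N ⊕ S × Bool) : R.cutEdge r m 0 = R.cutVertex r (R.cutParent m) := by
  rcases m with v | l
  · exact (R.edge_zero _).trans (R.cutVertex_map_inl _).symm
  · simp only [cutEdge, cutParent, zero_mul, R.ray_zero, cutVertex_map_inl]

lemma cutEdge_one (m : N ⊕ S × Bool) : R.cutEdge r m 1 = R.cutVertex r (some m) := by
  rcases m with v | l
  · simp only [cutEdge, cutVertex, R.edge_one, R.tgt_inl]
  · simp only [cutEdge, cutVertex, one_mul]

lemma exists_eq_of_mem_cutTree (hr : IsCutDepth r) {x : G} (hx : x ∈ R.cutTree r) :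
    (∃ w ∉ some '' range (Sum.inr : S × Bool → N ⊕ S × Bool), R.cutVertex r w = x) ∨
      ∃ m, ∃ t ∈ Ioo (0 : ℝ) 1, R.cutEdge r m t = x := by
  rcases R.exists_eq x with ⟨w, rfl⟩ | ⟨v | i, t, ht, rfl⟩
  · exact Or.inl ⟨_, map_inl_notMem_ends w, R.cutVertex_map_inl w⟩
  · exact Or.inr ⟨Sum.inl v, t, ht, rfl⟩
  · obtain ⟨σ, hσ⟩ := (R.edge_inr_mem_cutTree_iff hr i (Ioo_subset_Icc_self ht)).1 hx
    refine Or.inr ⟨Sum.inr (i, σ), endDist σ t / r (i, σ),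
      hr.div_mem_Ioo ⟨(endDist_mem_Ioo ht).1, hσ⟩, ?_⟩
    simp only [cutEdge, div_mul_cancel₀ _ (hr.pos _).ne']
    exact R.ray_endDist (i, σ) t

open Classical in
/-- The coordinate along the edge `m` of the cut tree in terms of the edge parameters. -/
noncomputable def cutCoordEdge (r : S × Bool → ℝ) (m : N ⊕ S × Bool) : N ⊕ S → ℝ → ℝ
  | Sum.inl v, t =>
    if m = Sum.inl v then t else descendantIndicator R.cutParent m (R.cutParent (Sum.inl v))
  | Sum.inr i, t =>
    let l := (i, decide (t < r (i, true)))
    if m = Sum.inr l then endDist l.2 t / r l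
    else descendantIndicator R.cutParent m (R.cutParent (Sum.inr l))

/-- The coordinate along the edge `m` of the cut tree. -/
noncomputable def cutCoord (r : S × Bool → ℝ) (m : N ⊕ S × Bool) : G → ℝ :=
  R.lift (fun w => descendantIndicator R.cutParent m (w.map Sum.inl)) (R.cutCoordEdge r m)

open Classical in
lemma cutCoordEdge_inr (hr : IsCutDepth r) (m : N ⊕ S × Bool) {l : S × Bool} {t : ℝ}
    (ht : endDist l.2 t < r l) : R.cutCoordEdge r m (Sum.inr l.1) t =
      if m = Sum.inr l then endDist l.2 t / r l
      else descendantIndicator R.cutParent m (R.cutParent (Sum.inr l)) := by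
  simp only [cutCoordEdge, hr.decide_lt_eq ht]

lemma cutCoordEdge_inr_endDist_zero (hr : IsCutDepth r) (m : N ⊕ S × Bool) (l : S × Bool) :
    R.cutCoordEdge r m (Sum.inr l.1) (endDist l.2 0) =
      descendantIndicator R.cutParent m ((R.base l).map Sum.inl) := by
  rw [R.cutCoordEdge_inr hr m (by rw [endDist_endDist]; exact hr.pos l), endDist_endDist, zero_div]
  split_ifs with h
  · rw [h]
    exact (descendantIndicator_parent R.cutDepth_cutParent_lt (Sum.inr l)).symm
  · rfl

lemma continuousOn_cutCoordEdge (hr : IsCutDepth r) (m : N ⊕ S × Bool) (e : N ⊕ S) :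
    ContinuousOn (R.cutCoordEdge r m e) (Icc (0 : ℝ) 1 ∩ R.edge e ⁻¹' R.cutTree r) := by
  rcases e with v | i
  · by_cases hm : m = Sum.inl v
    · exact continuousOn_id.congr fun t _ => if_pos hm
    · exact continuousOn_const.congr fun t _ => if_neg hm
  · rintro t ⟨ht, htT⟩
    obtain ⟨σ, hσ⟩ := (R.edge_inr_mem_cutTree_iff hr i ht).1 htT
    have hnear : ∀ᶠ u in 𝓝 t, endDist σ u < r (i, σ) :=
      (continuous_endDist σ).continuousAt.eventually_lt_const hσ
    refine (ContinuousAt.congr ?_ (hnear.mono fun u hu =>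
      (R.cutCoordEdge_inr hr m (l := (i, σ)) hu).symm)).continuousWithinAt
    split_ifs <;> fun_prop

lemma continuousOn_cutCoord [T2Space G] [Finite N] [Finite S] (hr : IsCutDepth r)
    (m : N ⊕ S × Bool) : ContinuousOn (R.cutCoord r m) (R.cutTree r) := by
  refine R.continuousOn_lift (R.isOpen_cutTree hr) ?_ ?_ (R.continuousOn_cutCoordEdge hr m)
  · rintro (v | i)
    · simp only [cutCoordEdge]
      split_ifs with h
      · rw [h]
        exact (descendantIndicator_parent R.cutDepth_cutParent_lt (Sum.inl v)).symm
      · rfl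
    · simpa using! R.cutCoordEdge_inr_endDist_zero hr m (i, true)
  · rintro (v | i)
    · simp only [cutCoordEdge, R.tgt_inl, Option.map_some]
      split_ifs with h
      · rw [h, descendantIndicator_self]
      · rw [descendantIndicator_some_of_ne h]
    · simpa [endDist] using! R.cutCoordEdge_inr_endDist_zero hr m (i, false)

open Classical in
lemma cutCoord_cutEdge (hr : IsCutDepth r) (m m' : N ⊕ S × Bool) {t : ℝ}
    (ht : t ∈ Ioo (0 : ℝ) 1) : R.cutCoord r m (R.cutEdge r m' t) =
      if m = m' then t else descendantIndicator R.cutParent m (R.cutParent m') := by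
  rcases m' with v | l
  · exact R.lift_edge _ _ _ ht
  · have hmem := hr.mul_mem_Ioo l ht
    rw [cutCoord, cutEdge, ray, R.lift_edge _ _ _ (endDist_mem_Ioo (hr.Ioo_subset l hmem)),
      R.cutCoordEdge_inr hr m (by rw [endDist_endDist]; exact hmem.2), endDist_endDist,
      mul_div_cancel_right₀ _ (hr.pos l).ne']

/-- The cut tree as an open tree, whose removed leaves are the points at which the non-tree edges
are cut. -/
noncomputable def openTree [T2Space G] [Finite N] [Finite S] (hr : IsCutDepth r) :
    OpenTree G (N ⊕ S × Bool) where
  parent := R.cutParent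
  depth := R.cutDepth
  depth_parent_lt := R.cutDepth_cutParent_lt
  ends := range Sum.inr
  parent_notMem m := by cases m <;> exact map_inl_notMem_ends _
  carrier := R.cutTree r
  vertex := R.cutVertex r
  edge := R.cutEdge r
  coord := R.cutCoord r
  vertex_mem w hw := by
    obtain ⟨u, rfl⟩ := exists_eq_map_inl hw
    rw [cutVertex_map_inl]
    exact R.vertex_mem_cutTree hr u
  edge_mem := R.cutEdge_mem hr
  continuousOn_edge := R.continuousOn_cutEdge hr
  edge_zero := R.cutEdge_zero
  edge_one := R.cutEdge_one
  exists_eq _ hx := R.exists_eq_of_mem_cutTree hr hx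
  continuousOn_coord := R.continuousOn_cutCoord hr
  coord_vertex m w hw := by
    obtain ⟨u, rfl⟩ := exists_eq_map_inl hw
    rw [cutVertex_map_inl]
    exact R.lift_vertex _ _ _
  coord_edge_self m t ht := by rw [R.cutCoord_cutEdge hr m m ht, if_pos rfl]
  coord_edge_of_ne m m' h t ht := by rw [R.cutCoord_cutEdge hr m m' ht, if_neg h]

/-- The self-map `g` of the cut tree points outwards at the end `l`: it moves the points of the
half-edge `l` along that half-edge, away from its vertex. -/
def PointsOutward (r : S × Bool → ℝ) (g : G → G) (l : S × Bool) : Prop :=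
  ∀ t ∈ Ioo 0 (r l), ∃ u ∈ Ioo t (r l), g (R.ray l t) = R.ray l u

variable {R}

lemma pointsForward_openTree_iff [T2Space G] [Finite N] [Finite S] (hr : IsCutDepth r) {g : G → G}
    (hg : FixedPointFreeOn g (R.cutTree r)) (l : S × Bool) :
    (R.openTree hr).PointsForward g (Sum.inr l) ↔ R.PointsOutward r g l := by
  have hl := hr.pos l
  refine (OpenTree.pointsForward_end_iff (T := R.openTree hr) hg (mem_range_self l)).trans
    ⟨fun H t ht => ?_, fun H t ht => ?_⟩
  · obtain ⟨u, hu, hgu⟩ := H _ (hr.div_mem_Ioo ht)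
    refine ⟨u * r l, ⟨(div_lt_iff₀ hl).1 hu.1, mul_lt_of_lt_one_left hl hu.2⟩, ?_⟩
    simpa only [openTree, cutEdge, div_mul_cancel₀ _ hl.ne'] using hgu
  · obtain ⟨u, hu, hgu⟩ := H _ (hr.mul_mem_Ioo l ht)
    refine ⟨u / r l, ⟨(lt_div_iff₀ hl).2 hu.1, (div_lt_one hl).2 hu.2⟩, ?_⟩
    simpa only [openTree, cutEdge, div_mul_cancel₀ _ hl.ne'] using hgu

theorem existsUnique_pointsOutward [T2Space G] [Finite N] [Finite S] (hr : IsCutDepth r)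
    {g : G → G} (hg : FixedPointFreeOn g (R.cutTree r)) : ∃! l, R.PointsOutward r g l := by
  obtain ⟨_, ⟨⟨l, rfl⟩, hl⟩, hunique⟩ :=
    OpenTree.existsUnique_end_pointsForward (T := R.openTree hr) hg
  refine ⟨l, (pointsForward_openTree_iff hr hg l).1 hl, fun l' hl' => Sum.inr_injective (α := N) ?_⟩
  exact hunique _ ⟨mem_range_self l', (pointsForward_openTree_iff hr hg l').2 hl'⟩

end RootedGraph

namespace GraphModel

variable {G : Type*} [TopologicalSpace G] [T2Space G] {V E : Type*} (M : GraphModel G V E) (e : E)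
  {Z : Type*} [TopologicalSpace Z] {φ : Z → G} {s t : Z → ℝ}

lemma isOpen_setOf_mem_image_Ioo [Finite V] [Finite E] (hφ : Continuous φ) (hs : Continuous s)
    (ht : Continuous t) (hs0 : ∀ z, 0 ≤ s z) (ht1 : ∀ z, t z ≤ 1) :
    IsOpen {z | φ z ∈ M.edge e '' Ioo (s z) (t z)} := by
  rw [isOpen_iff_mem_nhds]
  rintro z₀ ⟨u, hu, huz⟩
  obtain ⟨a, ha, ha'⟩ := exists_between hu.1
  obtain ⟨b, hb, hb'⟩ := exists_between hu.2
  have hab : M.edge e '' Ioo a b ∈ 𝓝 (φ z₀) :=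
    (M.isOpen_image_edge e isOpen_Ioo
      (Ioo_subset_Ioo ((hs0 z₀).trans ha.le) (hb'.le.trans (ht1 z₀)))).mem_nhds
      ⟨u, ⟨ha', hb⟩, huz⟩
  filter_upwards [hφ.continuousAt hab, hs.continuousAt.eventually_lt_const ha,
    ht.continuousAt.eventually_const_lt hb'] with z hz hsz htz
  exact image_mono (Ioo_subset_Ioo hsz.le htz.le) hz

-- Since `φ` avoids the ends of the arc, the arc may be replaced by the closed one.
lemma isClosed_setOf_mem_image_Ioo (hφ : Continuous φ) (hs : Continuous s) (ht : Continuous t)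
    (hs0 : ∀ z, 0 ≤ s z) (ht1 : ∀ z, t z ≤ 1) (hφs : ∀ z, φ z ≠ M.edge e (s z))
    (hφt : ∀ z, φ z ≠ M.edge e (t z)) : IsClosed {z | φ z ∈ M.edge e '' Ioo (s z) (t z)} := by
  have hproj : {z | φ z ∈ M.edge e '' Ioo (s z) (t z)} =
      Prod.fst '' {p : Z × Icc (0 : ℝ) 1 | s p.1 ≤ p.2 ∧ p.2 ≤ t p.1 ∧
        φ p.1 = M.edge e p.2} := by
    ext z
    constructor
    · rintro ⟨u, hu, huz⟩
      exact ⟨(z, ⟨u, (hs0 z).trans hu.1.le, hu.2.le.trans (ht1 z)⟩),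
        ⟨hu.1.le, hu.2.le, huz.symm⟩, rfl⟩
    · rintro ⟨⟨z, u⟩, ⟨hsu, hut, huz⟩, rfl⟩
      exact ⟨u, ⟨hsu.lt_of_ne fun h => hφs z (by rw [huz, h]),
        hut.lt_of_ne fun h => hφt z (by rw [huz, h])⟩, huz.symm⟩
  have hedge : Continuous fun p : Z × Icc (0 : ℝ) 1 => M.edge e p.2 :=
    (continuousOn_iff_continuous_domRestrict.1 (M.continuousOn_edge e)).comp continuous_snd
  rw [hproj]
  refine isClosedMap_fst_of_compactSpace _ (IsClosed.and ?_ (IsClosed.and ?_ ?_))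
  · exact isClosed_le (by fun_prop) (by fun_prop)
  · exact isClosed_le (by fun_prop) (by fun_prop)
  · exact isClosed_eq (by fun_prop) hedge

lemma mem_image_Ioo_of_preconnectedSpace [Finite V] [Finite E] [PreconnectedSpace Z]
    (hφ : Continuous φ) (hs : Continuous s) (ht : Continuous t) (hs0 : ∀ z, 0 ≤ s z)
    (ht1 : ∀ z, t z ≤ 1) (hφs : ∀ z, φ z ≠ M.edge e (s z)) (hφt : ∀ z, φ z ≠ M.edge e (t z))
    {z z' : Z} (hz : φ z ∈ M.edge e '' Ioo (s z) (t z)) :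
    φ z' ∈ M.edge e '' Ioo (s z') (t z') :=
  (IsClopen.eq_univ ⟨M.isClosed_setOf_mem_image_Ioo e hφ hs ht hs0 ht1 hφs hφt,
    M.isOpen_setOf_mem_image_Ioo e hφ hs ht hs0 ht1⟩ ⟨z, hz⟩).ge (mem_univ z')

end GraphModel

namespace RootedGraph

variable {G : Type*} [TopologicalSpace G] {N S : Type*} (R : RootedGraph G N S)

/-- The spanning tree, as a subspace. -/
def treeSet : Set G := range R.vertex ∪ ⋃ v, R.edge (Sum.inl v) '' Icc 0 1

lemma vertex_mem_treeSet (w : Option N) : R.vertex w ∈ R.treeSet := Or.inl ⟨w, rfl⟩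

lemma image_edge_inl_subset_treeSet (v : N) : R.edge (Sum.inl v) '' Icc 0 1 ⊆ R.treeSet :=
  fun _ hx => Or.inr (mem_iUnion.2 ⟨v, hx⟩)

lemma isPreconnected_treeSet : IsPreconnected R.treeSet := by
  have hedge : ∀ v, IsPreconnected (R.edge (Sum.inl v) '' Icc 0 1) := fun v =>
    isPreconnected_Icc.image _ (R.continuousOn_edge _)
  have hvertex : ∀ w : Option N, ∃ C ⊆ R.treeSet, R.vertex none ∈ C ∧ R.vertex w ∈ C ∧
      IsPreconnected C := by
    intro w
    induction h : R.depth w using Nat.strong_induction_on generalizing w with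
    | _ k ih =>
      cases w with
      | none => exact ⟨{R.vertex none}, singleton_subset_iff.2 (R.vertex_mem_treeSet _), rfl, rfl,
          isPreconnected_singleton⟩
      | some v =>
        obtain ⟨C, hC, hroot, hsrc, hpre⟩ := ih _ (h ▸ R.depth_src_lt v) _ rfl
        exact ⟨_, union_subset hC (R.image_edge_inl_subset_treeSet v), Or.inl hroot,
          Or.inr ⟨1, by simp, by rw [R.edge_one, R.tgt_inl]⟩,
          hpre.union _ hsrc ⟨0, by simp, R.edge_zero _⟩ (hedge v)⟩
  refine isPreconnected_of_forall (R.vertex none) fun y hy => ?_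
  rcases hy with ⟨w, rfl⟩ | hy
  · exact hvertex w
  · obtain ⟨v, hv⟩ := mem_iUnion.1 hy
    obtain ⟨C, hC, hroot, hv', hpre⟩ := hvertex (some v)
    exact ⟨_, union_subset hC (R.image_edge_inl_subset_treeSet v), Or.inl hroot, Or.inr hv,
      hpre.union _ hv' ⟨1, by simp, by rw [R.edge_one, R.tgt_inl]⟩ (hedge v)⟩

lemma isPreconnected_treeSet_union_ray (l : S × Bool) {J : Set ℝ} (hJ : J.OrdConnected)
    (h0 : 0 ∈ J) (hJ1 : J ⊆ Icc 0 1) : IsPreconnected (R.treeSet ∪ R.ray l '' J) :=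
  R.isPreconnected_treeSet.union (R.ray l 0)
    (by rw [R.ray_zero]; exact R.vertex_mem_treeSet _) (mem_image_of_mem _ h0)
    (hJ.isPreconnected.image _ ((R.continuousOn_ray l).mono hJ1))

lemma edge_inr_notMem_treeSet {i : S} {t : ℝ} (ht : t ∈ Ioo (0 : ℝ) 1) :
    R.edge (Sum.inr i) t ∉ R.treeSet := by
  rintro (⟨w, hw⟩ | h)
  · exact R.edge_ne_vertex ht hw.symm
  · obtain ⟨v, x, hx, hxt⟩ := mem_iUnion.1 h
    have hmem : R.edge (Sum.inl v) x ∈ R.edge (Sum.inr i) '' {t} := ⟨t, rfl, hxt.symm⟩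
    rw [R.edge_mem_image_iff hx (by simpa using ht)] at hmem
    simp at hmem

lemma edge_inr_mem_ray_image_iff {i : S} {l : S × Bool} {t : ℝ} {J : Set ℝ}
    (ht : t ∈ Ioo (0 : ℝ) 1) (hJ : J ⊆ Icc 0 1) :
    R.edge (Sum.inr i) t ∈ R.ray l '' J ↔ i = l.1 ∧ endDist l.2 t ∈ J := by
  constructor
  · rintro ⟨x, hx, hxt⟩
    have hmem : R.ray l x ∈ R.edge (Sum.inr i) '' {t} := ⟨t, rfl, hxt.symm⟩
    rw [ray, R.edge_mem_image_iff (endDist_mem_Icc (hJ hx)) (by simpa using ht),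
      mem_singleton_iff] at hmem
    obtain ⟨hli, rfl⟩ := hmem
    exact ⟨(Sum.inr.inj hli).symm, by rwa [endDist_endDist]⟩
  · rintro ⟨rfl, h⟩
    exact ⟨_, h, R.ray_endDist l t⟩

lemma cutTree_eq {r : S × Bool → ℝ} (hr : IsCutDepth r) :
    R.cutTree r = R.treeSet ∪ ⋃ l, R.ray l '' Ico 0 (r l) := by
  ext x
  simp only [mem_union, mem_iUnion]
  constructor
  · intro hx
    rcases R.exists_eq x with ⟨w, rfl⟩ | ⟨v | i, t, ht, rfl⟩
    · exact Or.inl (R.vertex_mem_treeSet w)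
    · exact Or.inl (R.image_edge_inl_subset_treeSet v ⟨t, Ioo_subset_Icc_self ht, rfl⟩)
    · obtain ⟨σ, hσ⟩ := (R.edge_inr_mem_cutTree_iff hr i (Ioo_subset_Icc_self ht)).1 hx
      exact Or.inr ⟨(i, σ), endDist σ t, ⟨(endDist_mem_Ioo ht).1.le, hσ⟩, R.ray_endDist _ _⟩
  · rintro ((⟨w, rfl⟩ | h) | ⟨l, t, ht, rfl⟩)
    · exact R.vertex_mem_cutTree hr w
    · obtain ⟨v, t, ht, rfl⟩ := mem_iUnion.1 h
      exact R.edge_inl_mem_cutTree hr v ht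
    · exact R.ray_mem_cutTree hr l ht

lemma isPreconnected_cutTree {r : S × Bool → ℝ} (hr : IsCutDepth r) :
    IsPreconnected (R.cutTree r) := by
  rw [R.cutTree_eq hr]
  refine isPreconnected_of_forall (R.vertex none) fun x hx => ?_
  rcases hx with hx | hx
  · exact ⟨_, subset_union_left, R.vertex_mem_treeSet _, hx, R.isPreconnected_treeSet⟩
  · obtain ⟨l, hl⟩ := mem_iUnion.1 hx
    exact ⟨_, union_subset_union_right _ (subset_iUnion _ l), Or.inl (R.vertex_mem_treeSet _),
      Or.inr hl, R.isPreconnected_treeSet_union_ray l ordConnected_Ico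
        (left_mem_Ico.2 (hr.pos l)) fun t ht => ⟨ht.1, (ht.2.trans (hr.lt_one l)).le⟩⟩

end RootedGraph

section Placements

variable {S ι : Type*}

/-- Pairwise distinct positions in the interiors of non-tree edges; the pair `(i, t)` stands for
the point with parameter `t` on the edge `i`. -/
structure IsPlacement (c : ι → S × ℝ) : Prop where
  injective : Function.Injective c
  mem : ∀ j, (c j).2 ∈ Ioo (0 : ℝ) 1

/-- The positions on the non-tree edge `i` with parameters in `[s, t]`. -/
def arc (i : S) (s t : ℝ) : Set (S × ℝ) := {z | z.1 = i ∧ z.2 ∈ Icc s t}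

/-- The positions on the edge `l.1` whose distance from the end `l.2` belongs to `J`. -/
def alongEnd (l : S × Bool) (J : Set ℝ) : Set (S × ℝ) := {z | z.1 = l.1 ∧ endDist l.2 z.2 ∈ J}

lemma arc_mono {i : S} {s s' t : ℝ} (h : s ≤ s') : arc i s' t ⊆ arc i s t :=
  fun _ hz => ⟨hz.1, h.trans hz.2.1, hz.2.2⟩

lemma injective_update_of_forall_ne {X : Type*} [DecidableEq ι] {f : ι → X} {j : ι} {x : X}
    (hf : InjOn f {j}ᶜ) (hx : ∀ k ≠ j, f k ≠ x) : Function.Injective (Function.update f j x) := by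
  intro a b hab
  by_cases ha : a = j <;> by_cases hb : b = j
  · rw [ha, hb]
  · rw [ha, Function.update_self, Function.update_of_ne hb] at hab
    exact absurd hab.symm (hx b hb)
  · rw [hb, Function.update_self, Function.update_of_ne ha] at hab
    exact absurd hab (hx a ha)
  · rw [Function.update_of_ne ha, Function.update_of_ne hb] at hab
    exact hf ha hb hab

lemma IsPlacement.update [DecidableEq ι] {c : ι → S × ℝ} (hc : IsPlacement c) {j : ι} {z : S × ℝ}
    (hz : z.2 ∈ Ioo (0 : ℝ) 1) (hne : ∀ k ≠ j, c k ≠ z) :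
    IsPlacement (Function.update c j z) where
  injective := injective_update_of_forall_ne hc.injective.injOn hne
  mem := Function.forall_update_iff c (fun _ z => z.2 ∈ Ioo (0 : ℝ) 1) |>.2
    ⟨hz, fun k _ => hc.mem k⟩

lemma IsPlacement.exists_lt_endDist [Finite ι] {c : ι → S × ℝ} (hc : IsPlacement c) (σ : Bool)
    {θ : ℝ} (hθ : 0 < θ) : ∃ δ ∈ Ioo 0 θ, ∀ j, δ < endDist σ (c j).2 := by
  have hsmall : ∀ᶠ δ in 𝓝[>] (0 : ℝ), δ < θ ∧ ∀ j, δ < endDist σ (c j).2 :=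
    nhdsWithin_le_nhds ((eventually_lt_nhds hθ).and
      (eventually_all.2 fun j => eventually_lt_nhds (endDist_mem_Ioo (hc.mem j)).1))
  obtain ⟨δ, ⟨hδθ, hδ⟩, hδ0⟩ := (hsmall.and self_mem_nhdsWithin).exists
  exact ⟨δ, ⟨hδ0, hδθ⟩, hδ⟩

end Placements

namespace RootedGraph

variable {G : Type*} [TopologicalSpace G] {N S ι : Type*} (R : RootedGraph G N S)
  {A A' : Set (S × ℝ)} {c c' : ι → S × ℝ}

/-- The point of `G` at a position on a non-tree edge. -/
def point (z : S × ℝ) : G := R.edge (Sum.inr z.1) z.2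

/-- The configuration of points of `G` given by positions on non-tree edges. -/
def place (c : ι → S × ℝ) (j : ι) : G := R.point (c j)

lemma place_injective (hc : IsPlacement c) : Function.Injective (R.place c) := by
  intro j j' h
  obtain ⟨hfst, hsnd⟩ := R.edge_inj (hc.mem j) (hc.mem j') h
  exact hc.injective (Prod.ext (Sum.inr.inj hfst) hsnd)

/-- The placement `c'` arises from `c` by moving one token through a connected set which avoids
the other tokens and the positions in `A`. -/
def Slide (A : Set (S × ℝ)) (c c' : ι → S × ℝ) : Prop :=
  IsPlacement c ∧ IsPlacement c' ∧ ∃ j, (∀ k ≠ j, c k = c' k) ∧ ∃ C : Set G,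
    IsPreconnected C ∧ R.place c j ∈ C ∧ R.place c' j ∈ C ∧ ∀ z ∈ A ∪ c '' {j}ᶜ, R.point z ∉ C

/-- The placements `c` and `c'` are connected by slides. -/
def Reach (A : Set (S × ℝ)) : (ι → S × ℝ) → (ι → S × ℝ) → Prop :=
  Relation.ReflTransGen (R.Slide A)

variable {R}

lemma Slide.symm (h : R.Slide A c c') : R.Slide A c' c := by
  obtain ⟨hc, hc', j, hj, C, hC, hcC, hcC', hA⟩ := h
  have himage : c' '' {j}ᶜ = c '' {j}ᶜ := image_congr fun k hk => (hj k hk).symm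
  exact ⟨hc', hc, j, fun k hk => (hj k hk).symm, C, hC, hcC', hcC, by rwa [himage]⟩

lemma Reach.symm (h : R.Reach A c c') : R.Reach A c' c := by
  have : Std.Symm (R.Slide A (ι := ι)) := ⟨fun _ _ h => h.symm⟩
  exact Std.Symm.symm (r := Relation.ReflTransGen (R.Slide A)) _ _ h

lemma Slide.anti (hA : A ⊆ A') (h : R.Slide A' c c') : R.Slide A c c' := by
  obtain ⟨hc, hc', j, hj, C, hC, hcC, hcC', hA'⟩ := h
  exact ⟨hc, hc', j, hj, C, hC, hcC, hcC', fun z hz => hA' z (hz.imp_left (@hA z))⟩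

lemma Reach.anti (hA : A ⊆ A') (h : R.Reach A' c c') : R.Reach A c c' :=
  Relation.ReflTransGen.mono (fun _ _ h => Slide.anti hA h) _ _ h

lemma Slide.apply_eq (h : R.Slide A c c') {j : ι} (hj : c j ∈ A) : c' j = c j := by
  obtain ⟨-, -, k, hk, C, -, hcC, -, hA⟩ := h
  by_cases hjk : j = k
  · subst hjk
    exact absurd hcC (hA _ (Or.inl hj))
  · exact (hk j hjk).symm

lemma Reach.apply_eq (h : R.Reach A c c') {j : ι} (hj : c j ∈ A) : c' j = c j := by
  induction h with
  | refl => rfl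
  | tail _ h ih => exact (Slide.apply_eq h (by rwa [ih])).trans ih

lemma Reach.isPlacement (h : R.Reach A c c') (hc : IsPlacement c) : IsPlacement c' := by
  induction h with
  | refl => exact hc
  | tail _ h _ => exact h.2.1

lemma point_notMem_treeSet_union_ray {l : S × Bool} {x : ℝ} (hx : x ∈ Icc (0 : ℝ) 1) {z : S × ℝ}
    (hz : z.2 ∈ Ioo (0 : ℝ) 1) (hzl : z ∉ alongEnd l (Iic x)) :
    R.point z ∉ R.treeSet ∪ R.ray l '' Icc 0 x := by
  rintro (h | h)
  · exact R.edge_inr_notMem_treeSet hz h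
  · obtain ⟨hzl', hzx⟩ := (R.edge_inr_mem_ray_image_iff hz (Icc_subset_Icc_right hx.2)).1 h
    exact hzl ⟨hzl', hzx.2⟩

lemma slide_update [DecidableEq ι] (hA : ∀ z ∈ A, z.2 ∈ Ioo (0 : ℝ) 1) (hc : IsPlacement c) {j : ι}
    {l l' : S × Bool} (hjl : (c j).1 = l.1)
    (hl : ∀ z ∈ A ∪ c '' {j}ᶜ, z ∉ alongEnd l (Iic (endDist l.2 (c j).2)))
    {x : ℝ} (hx : x ∈ Ioo (0 : ℝ) 1) (hl' : ∀ z ∈ A ∪ c '' {j}ᶜ, z ∉ alongEnd l' (Iic x)) :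
    R.Slide A c (Function.update c j (l'.1, endDist l'.2 x)) := by
  have hcj : endDist l.2 (c j).2 ∈ Icc (0 : ℝ) 1 :=
    Ioo_subset_Icc_self (endDist_mem_Ioo (hc.mem j))
  have hx' := Ioo_subset_Icc_self hx
  have hne : ∀ k ≠ j, c k ≠ (l'.1, endDist l'.2 x) := fun k hk heq =>
    hl' (c k) (Or.inr ⟨k, hk, rfl⟩) (by rw [heq]; exact ⟨rfl, (endDist_endDist _ _).le⟩)
  refine ⟨hc, hc.update (endDist_mem_Ioo hx) hne, j,
    fun k hk => (Function.update_of_ne hk _ _).symm,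
    (R.treeSet ∪ R.ray l '' Icc 0 (endDist l.2 (c j).2)) ∪ (R.treeSet ∪ R.ray l' '' Icc 0 x),
    ?_, Or.inl (Or.inr ⟨_, right_mem_Icc.2 hcj.1, ?_⟩), Or.inr (Or.inr ⟨x, ⟨hx.1.le, le_rfl⟩, ?_⟩),
    ?_⟩
  · exact (R.isPreconnected_treeSet_union_ray l ordConnected_Icc (left_mem_Icc.2 hcj.1)
        (Icc_subset_Icc_right hcj.2)).union (R.vertex none) (Or.inl (R.vertex_mem_treeSet _))
      (Or.inl (R.vertex_mem_treeSet _)) (R.isPreconnected_treeSet_union_ray l' ordConnected_Icc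
        (left_mem_Icc.2 hx'.1) (Icc_subset_Icc_right hx'.2))
  · rw [ray_endDist, ← hjl]
    rfl
  · rw [place, Function.update_self]
    rfl
  · intro z hz
    have hz1 : z.2 ∈ Ioo (0 : ℝ) 1 := by
      rcases hz with hz | ⟨k, -, rfl⟩
      exacts [hA z hz, hc.mem k]
    exact not_or.2 ⟨point_notMem_treeSet_union_ray hcj hz1 (hl z hz),
      point_notMem_treeSet_union_ray hx' hz1 (hl' z hz)⟩

lemma exists_slide_alongEnd [Finite ι] [DecidableEq ι] (hA : ∀ z ∈ A, z.2 ∈ Ioo (0 : ℝ) 1)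
    (hc : IsPlacement c) {j : ι} {l l' : S × Bool} (hjl : (c j).1 = l.1)
    (hl : ∀ z ∈ A ∪ c '' {j}ᶜ, z ∉ alongEnd l (Iic (endDist l.2 (c j).2)))
    {θ : ℝ} (hθ : θ ∈ Ioc (0 : ℝ) 1) (hl' : ∀ z ∈ A, z ∉ alongEnd l' (Iio θ)) :
    ∃ z ∈ alongEnd l' (Iio θ), R.Slide A c (Function.update c j z) := by
  obtain ⟨δ, hδ, hδc⟩ := hc.exists_lt_endDist l'.2 hθ.1
  refine ⟨(l'.1, endDist l'.2 δ), ⟨rfl, by rw [endDist_endDist]; exact hδ.2⟩,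
    slide_update hA hc hjl hl ⟨hδ.1, hδ.2.trans_le hθ.2⟩ ?_⟩
  rintro z (hz | ⟨k, -, rfl⟩) ⟨hzl, hzδ⟩
  · exact hl' z hz ⟨hzl, hzδ.trans_lt hδ.2⟩
  · exact hzδ.not_gt (hδc k)

-- The tokens leave one after the other, beginning with the one closest to the end.
lemma exists_reach_evacuate [Finite ι] (hA : ∀ z ∈ A, z.2 ∈ Ioo (0 : ℝ) 1) {l l' : S × Bool}
    (hll : l'.1 ≠ l.1) {ρ θ : ℝ} (hθ : θ ∈ Ioc (0 : ℝ) 1) (hl : ∀ z ∈ A, z ∉ alongEnd l (Iio ρ))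
    (hl' : ∀ z ∈ A, z ∉ alongEnd l' (Iio θ)) (hc : IsPlacement c) :
    ∃ c', R.Reach A c c' ∧ (∀ j, c' j ∉ alongEnd l (Iio ρ)) ∧
      ∀ j, c' j = c j ∨ (c j ∈ alongEnd l (Iio ρ) ∧ c' j ∈ alongEnd l' (Iio θ)) := by
  classical
  induction hn : {j | c j ∈ alongEnd l (Iio ρ)}.ncard using Nat.strong_induction_on
    generalizing c with
  | _ n ih =>
    rcases {j | c j ∈ alongEnd l (Iio ρ)}.eq_empty_or_nonempty with hempty | hne
    · exact ⟨c, Relation.ReflTransGen.refl, fun j hj => hempty.le hj, fun j => Or.inl rfl⟩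
    obtain ⟨j, hj, hmin⟩ :=
      exists_min_image _ (fun j => endDist l.2 (c j).2) (toFinite _) hne
    have hclear : ∀ z ∈ A ∪ c '' {j}ᶜ, z ∉ alongEnd l (Iic (endDist l.2 (c j).2)) := by
      rintro z (hz | ⟨k, hk, rfl⟩) ⟨hzl, hzj⟩
      · exact hl z hz ⟨hzl, lt_of_le_of_lt (mem_Iic.1 hzj) (mem_Iio.1 hj.2)⟩
      · have hkj := hmin k ⟨hzl, lt_of_le_of_lt (mem_Iic.1 hzj) (mem_Iio.1 hj.2)⟩
        exact hk (hc.injective (Prod.ext (hzl.trans hj.1.symm)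
          (endDist_injective l.2 (le_antisymm hzj hkj))))
    obtain ⟨z, hz, hslide⟩ := exists_slide_alongEnd (R := R) hA hc hj.1 hclear hθ hl'
    have hzl : z ∉ alongEnd l (Iio ρ) := fun h => hll (hz.1.symm.trans h.1)
    have hfewer : {k | Function.update c j z k ∈ alongEnd l (Iio ρ)}.ncard < n := by
      rw [← hn]
      refine ncard_lt_ncard ⟨fun k hk => ?_, fun hsub => ?_⟩
      · have hkj : k ≠ j := by
          rintro rfl
          exact hzl (by simpa using hk)
        simpa [Function.update_of_ne hkj] using hk
      · exact hzl (by simpa using hsub hj)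
    obtain ⟨c', hreach, hout, hmoved⟩ := ih _ hfewer hslide.2.1 rfl
    refine ⟨c', Relation.ReflTransGen.head hslide hreach, hout, fun k => ?_⟩
    by_cases hkj : k = j
    · have := hmoved k
      rw [hkj, Function.update_self] at this
      rw [hkj]
      exact Or.inr ⟨hj, this.elim (fun h => h ▸ hz) fun h => h.2⟩
    · simpa only [Function.update_of_ne hkj] using hmoved k

section Arc

variable {i k : S} {s t : ℝ}

lemma snd_mem_Ioo_of_mem_arc (hs : 0 < s) (ht : t < 1) : ∀ z ∈ arc i s t, z.2 ∈ Ioo (0 : ℝ) 1 :=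
  fun _ hz => ⟨hs.trans_le hz.2.1, hz.2.2.trans_lt ht⟩

lemma exists_reach_clear_edge [Finite ι] (hki : k ≠ i) (hs : 0 < s) (ht : t < 1)
    (hc : IsPlacement c) :
    ∃ c', R.Reach (arc i s t) c c' ∧ ∀ j, (c' j).1 = i → c' j ∈ arc i s t := by
  have hA := snd_mem_Ioo_of_mem_arc (i := i) hs ht
  have hk : ∀ z ∈ arc i s t, z ∉ alongEnd (k, true) (Iio 1) := fun z hz h =>
    hki (h.1.symm.trans hz.1)
  obtain ⟨c₁, hreach₁, hout₁, -⟩ := exists_reach_evacuate (R := R) hA (l := (i, true))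
    (l' := (k, true)) hki (ρ := s) (by simp) (fun z hz h => h.2.not_ge hz.2.1) hk hc
  obtain ⟨c₂, hreach₂, hout₂, hmoved⟩ := exists_reach_evacuate (R := R) hA (l := (i, false))
    (l' := (k, true)) hki (ρ := 1 - t) (by simp)
    (fun z hz h => h.2.not_ge (sub_le_sub_left hz.2.2 1)) hk (hreach₁.isPlacement hc)
  refine ⟨c₂, hreach₁.trans hreach₂, fun j hj => ⟨hj, not_lt.1 fun hlt => ?_,
    not_lt.1 fun hlt => hout₂ j ⟨hj, sub_lt_sub_left hlt 1⟩⟩⟩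
  rcases hmoved j with h | ⟨-, h⟩
  · exact hout₁ j ⟨h ▸ hj, h ▸ hlt⟩
  · exact hki (h.1.symm.trans hj)

lemma exists_reach_expose [Finite ι] (hs : 0 < s) (hst : s ≤ t) (ht : t < 1)
    (hc : IsPlacement c) (hi : ∀ j, (c j).1 = i → c j ∈ arc i s t) {y : ι} (hy : (c y).1 ≠ i) :
    ∃ c', R.Reach (arc i s t) c c' ∧ c' y = c y ∧ (∀ j, (c' j).1 = i → s ≤ (c' j).2) ∧
      ∀ z ∈ arc i s t ∪ c' '' {y}ᶜ, z ∉ alongEnd ((c y).1, true) (Iic (c y).2) := by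
  obtain ⟨c', hreach, hout, hmoved⟩ := exists_reach_evacuate (R := R)
    (snd_mem_Ioo_of_mem_arc (i := i) hs ht) (l := ((c y).1, true)) (l' := (i, false)) hy.symm
    (ρ := (c y).2) (θ := 1 - t) ⟨by linarith, by linarith⟩
    (fun z hz h => hy (h.1.symm.trans hz.1))
    (fun z hz h => h.2.not_ge (sub_le_sub_left hz.2.2 1)) hc
  have hy' : c' y = c y := (hmoved y).resolve_right fun h => lt_irrefl (c y).2 h.1.2
  refine ⟨c', hreach, hy', fun j hj => ?_, ?_⟩
  · rcases hmoved j with h | ⟨-, -, h⟩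
    · rw [h] at hj ⊢
      exact (hi j hj).2.1
    · exact hst.trans (sub_lt_sub_iff_left 1 |>.1 h).le
  · rintro z (hz | ⟨j, hj, rfl⟩) ⟨hzy, hzle⟩
    · exact hy (hzy.symm.trans hz.1)
    · refine hout j ⟨hzy, mem_Iio.2 (lt_of_le_of_ne (mem_Iic.1 hzle) fun heq => hj ?_)⟩
      exact (hreach.isPlacement hc).injective (hy'.symm ▸ Prod.ext hzy heq)

lemma exists_reach_bring [Finite ι] (hki : k ≠ i) (hs : 0 < s) (hst : s ≤ t) (ht : t < 1)
    (hc : IsPlacement c) {y : ι} (hy : c y ∉ arc i s t) :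
    ∃ c', R.Reach (arc i s t) c c' ∧ c' y = (i, s / 2) ∧
      ∀ j ≠ y, c' j ∈ arc i (s / 2) t → c j ∈ arc i s t := by
  classical
  obtain ⟨c₁, hreach₁, hi₁⟩ := exists_reach_clear_edge (R := R) hki hs ht hc
  have hc₁ := hreach₁.isPlacement hc
  have hyi : (c₁ y).1 ≠ i := fun h => hy (hreach₁.symm.apply_eq (hi₁ y h) ▸ hi₁ y h)
  obtain ⟨c₂, hreach₂, hy₂, hi₂, hclear⟩ := exists_reach_expose (R := R) hs hst ht hc₁ hi₁ hyi
  have hslide : R.Slide (arc i s t) c₂ (Function.update c₂ y (i, s / 2)) := by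
    refine slide_update (l := ((c₁ y).1, true)) (l' := (i, true)) (x := s / 2)
      (snd_mem_Ioo_of_mem_arc hs ht) (hreach₂.isPlacement hc₁) (by rw [hy₂])
      (by rw [hy₂]; exact hclear) ⟨by linarith, by linarith⟩ ?_
    rintro z (hz | ⟨j, -, rfl⟩) ⟨hzi, hzs⟩ <;> rw [endDist_true, mem_Iic] at hzs
    · linarith [hz.2.1]
    · linarith [hi₂ j hzi]
  have hreach : R.Reach (arc i s t) c (Function.update c₂ y (i, s / 2)) :=
    (hreach₁.trans hreach₂).tail hslide
  refine ⟨_, hreach, Function.update_self .., fun j hj hmem => ?_⟩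
  have harc : Function.update c₂ y (i, s / 2) j ∈ arc i s t := by
    rw [Function.update_of_ne hj] at hmem ⊢
    exact ⟨hmem.1, hi₂ j hmem.1, hmem.2.2⟩
  rwa [← hreach.symm.apply_eq harc] at harc

-- A token outside the arc is brought to the same place next to the arc in both placements, and the
-- arc is enlarged so as to contain it.
theorem reach_of_eq_on_arc [Finite ι] (hki : k ≠ i) (hs : 0 < s) (hst : s ≤ t) (ht : t < 1)
    (hc : IsPlacement c) (hc' : IsPlacement c')
    (h : ∀ j, c j ∈ arc i s t ∨ c' j ∈ arc i s t → c j = c' j) : R.Reach (arc i s t) c c' := by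
  induction hn : {j | c j ∉ arc i s t}.ncard using Nat.strong_induction_on
    generalizing s c c' with
  | _ n ih =>
    by_cases hall : ∀ j, c j ∈ arc i s t
    · obtain rfl : c = c' := funext fun j => h j (Or.inl (hall j))
      exact Relation.ReflTransGen.refl
    push Not at hall
    obtain ⟨y, hy⟩ := hall
    have hy' : c' y ∉ arc i s t := fun hmem => hy (by rwa [h y (Or.inr hmem)])
    have harc := arc_mono (i := i) (t := t) (half_le_self hs.le)
    obtain ⟨d, hreach, hdy, hd⟩ := exists_reach_bring (R := R) hki hs hst ht hc hy
    obtain ⟨d', hreach', hdy', hd'⟩ := exists_reach_bring (R := R) hki hs hst ht hc' hy'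
    have hfewer : {j | d j ∉ arc i (s / 2) t}.ncard < n := by
      rw [← hn]
      refine ncard_lt_ncard ⟨fun j hj hmem => hj (harc ?_), fun hsub => hsub hy ?_⟩
      · rwa [hreach.apply_eq hmem]
      · rw [hdy]
        exact ⟨rfl, le_rfl, by linarith⟩
    have hagree : ∀ j, d j ∈ arc i (s / 2) t ∨ d' j ∈ arc i (s / 2) t → d j = d' j := by
      intro j hj
      by_cases hjy : j = y
      · rw [hjy, hdy, hdy']
      have hcj : c j ∈ arc i s t ∧ c j = c' j := by
        rcases hj with hj | hj
        · exact ⟨hd j hjy hj, h j (Or.inl (hd j hjy hj))⟩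
        · have heq := h j (Or.inr (hd' j hjy hj))
          exact ⟨heq ▸ hd' j hjy hj, heq⟩
      rw [hreach.apply_eq hcj.1, hreach'.apply_eq (hcj.2 ▸ hcj.1), hcj.2]
    have key := ih _ hfewer (by linarith) (by linarith) (hreach.isPlacement hc)
      (hreach'.isPlacement hc') hagree rfl
    exact (hreach.trans (key.anti harc)).trans hreach'.symm

end Arc

end RootedGraph

lemma exists_injective_mem_Ioo_of_priority {ι : Type*} [Finite ι] (pr : ι → ℕ) :
    ∃ ρ : ι → ℝ, Function.Injective ρ ∧ (∀ k, ρ k ∈ Ioo (0 : ℝ) 1) ∧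
      ∀ k k', pr k < pr k' → ρ k < ρ k' := by
  obtain ⟨n, ⟨e⟩⟩ := Finite.exists_equiv_fin ι
  have : Countable (ℕ ×ₗ Fin n) := inferInstanceAs (Countable (ℕ × Fin n))
  have := (Ioo_infinite (zero_lt_one' ℝ)).nontrivial.coe_sort
  obtain ⟨f⟩ := Order.embedding_from_countable_to_dense (ℕ ×ₗ Fin n) (Ioo (0 : ℝ) 1)
  refine ⟨fun k => f (toLex (pr k, e k)), fun k k' h => e.injective ?_, fun k => (f _).2,
    fun k k' h => f.lt_iff_lt.2 (Prod.Lex.toLex_lt_toLex.2 (Or.inl h))⟩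
  exact congr_arg (fun z => (ofLex z).2) (f.injective (Subtype.ext h))

/-- A function on tuples which is continuous on configurations and avoids all entries. -/
structure AvoidsTokens {ι G : Type*} [TopologicalSpace G] (F : (ι → G) → G) : Prop where
  continuousOn : ContinuousOn F {x | Function.Injective x}
  ne : ∀ x, Function.Injective x → ∀ j, F x ≠ x j

section Consecutive

variable {S ι : Type*} {c : ι → S × ℝ} {u v : ι}

/-- The token `v` comes directly after the token `u` on the edge `l.1`, seen from its end `l.2`. -/
structure IsConsecutive (l : S × Bool) (c : ι → S × ℝ) (u v : ι) : Prop where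
  fst_left : (c u).1 = l.1
  fst_right : (c v).1 = l.1
  lt : endDist l.2 (c u).2 < endDist l.2 (c v).2
  notMem : ∀ j, j ≠ u → j ≠ v →
    c j ∉ alongEnd l (Icc (endDist l.2 (c u).2) (endDist l.2 (c v).2))

lemma IsConsecutive.ne {l : S × Bool} (h : IsConsecutive l c u v) : u ≠ v := by
  rintro rfl
  exact lt_irrefl _ h.lt

lemma IsConsecutive.flip {i : S} {σ : Bool} (h : IsConsecutive (i, σ) c u v) :
    IsConsecutive (i, !σ) c v u := by
  cases σ
  · exact ⟨h.fst_right, h.fst_left, (sub_lt_sub_iff_left 1).1 h.lt, fun j hj hj' hmem =>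
      h.notMem j hj' hj ⟨hmem.1, sub_le_sub_left hmem.2.2 1, sub_le_sub_left hmem.2.1 1⟩⟩
  · exact ⟨h.fst_right, h.fst_left, sub_lt_sub_left h.lt 1, fun j hj hj' hmem =>
      h.notMem j hj' hj ⟨hmem.1, (sub_le_sub_iff_left 1).1 hmem.2.2,
        (sub_le_sub_iff_left 1).1 hmem.2.1⟩⟩

lemma exists_isConsecutive_mem_Ioo [Finite ι] (hc : Function.Injective c) {i : S} {z : ℝ}
    (hz : ∀ j, c j ≠ (i, z)) {a b : ι} (ha : (c a).1 = i) (hb : (c b).1 = i)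
    (haz : (c a).2 < z) (hzb : z < (c b).2) :
    ∃ u v, IsConsecutive (i, true) c u v ∧ z ∈ Ioo (c u).2 (c v).2 := by
  obtain ⟨u, ⟨hui, huz⟩, hu⟩ := exists_max_image {j | (c j).1 = i ∧ (c j).2 < z}
    (fun j => (c j).2) (toFinite _) ⟨a, ha, haz⟩
  obtain ⟨v, ⟨hvi, hzv⟩, hv⟩ := exists_min_image {j | (c j).1 = i ∧ z < (c j).2}
    (fun j => (c j).2) (toFinite _) ⟨b, hb, hzb⟩
  refine ⟨u, v, ⟨hui, hvi, huz.trans hzv, fun j hju hjv ⟨hji, hj⟩ => ?_⟩, huz, hzv⟩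
  rcases lt_trichotomy (c j).2 z with hjz | hjz | hjz
  · exact hju (hc (Prod.ext (hji.trans hui.symm) (le_antisymm (hu j ⟨hji, hjz⟩) hj.1)))
  · exact hz j (Prod.ext hji hjz)
  · exact hjv (hc (Prod.ext (hji.trans hvi.symm) (le_antisymm hj.2 (hv j ⟨hji, hjz⟩))))

/-- The possible pairs of parameters of two tokens in this order on the same edge. -/
def orderedParams : Set (ℝ × ℝ) := Ioo 0 1 ×ˢ Ioo 0 1 ∩ {p | p.1 < p.2}

lemma isPreconnected_orderedParams : IsPreconnected orderedParams := by
  have hlt : {p : ℝ × ℝ | p.1 < p.2} = (LinearMap.snd ℝ ℝ ℝ - LinearMap.fst ℝ ℝ ℝ) ⁻¹' Ioi 0 := by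
    ext p
    simp
  rw [orderedParams, hlt]
  exact (((convex_Ioo 0 1).prod (convex_Ioo 0 1)).inter
    ((convex_Ioi 0).linear_preimage _)).isPreconnected

lemma IsConsecutive.mem_orderedParams {i : S} (hc : IsPlacement c)
    (h : IsConsecutive (i, true) c u v) : ((c u).2, (c v).2) ∈ orderedParams :=
  ⟨⟨hc.mem u, hc.mem v⟩, h.lt⟩

/-- The tokens `u` and `v` are placed on the edge `i` at the parameters `p.1` and `p.2`, and every
other token `j` is placed on the edge `k` at the parameter `ρ j`. -/
def parked [DecidableEq ι] (i k : S) (ρ : ι → ℝ) (u v : ι) (p : ℝ × ℝ) : ι → S × ℝ :=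
  Function.update (Function.update (fun j => (k, ρ j)) v (i, p.2)) u (i, p.1)

variable [DecidableEq ι] {i k : S} {ρ : ι → ℝ}

lemma parked_left (p : ℝ × ℝ) : parked i k ρ u v p u = (i, p.1) := Function.update_self ..

lemma parked_right (huv : u ≠ v) (p : ℝ × ℝ) : parked i k ρ u v p v = (i, p.2) := by
  rw [parked, Function.update_of_ne huv.symm, Function.update_self]

lemma parked_of_ne {j : ι} (hu : j ≠ u) (hv : j ≠ v) (p : ℝ × ℝ) :
    parked i k ρ u v p j = (k, ρ j) := by
  rw [parked, Function.update_of_ne hu, Function.update_of_ne hv]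

lemma isPlacement_parked (hki : k ≠ i) (hρ : Function.Injective ρ)
    (hρ1 : ∀ j, ρ j ∈ Ioo (0 : ℝ) 1) {p : ℝ × ℝ} (hp : p ∈ orderedParams) :
    IsPlacement (parked i k ρ u v p) := by
  have hpark : IsPlacement fun j => (k, ρ j) := ⟨fun _ _ h => hρ (Prod.ext_iff.1 h).2, hρ1⟩
  refine (hpark.update hp.1.2 fun j _ h => hki (Prod.ext_iff.1 h).1).update hp.1.1 fun j _ h => ?_
  by_cases hjv : j = v
  · rw [hjv, Function.update_self] at h
    exact hp.2.ne' (Prod.ext_iff.1 h).2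
  · rw [Function.update_of_ne hjv] at h
    exact hki (Prod.ext_iff.1 h).1

end Consecutive

namespace RootedGraph

variable {G : Type*} [TopologicalSpace G] {N S ι : Type*} {R : RootedGraph G N S}
  {F : (ι → G) → G} {c c' : ι → S × ℝ} {u v : ι}

/-- The tokens `u` and `v` trap the value of `F` on the edge `l.1`: whenever `v` comes directly
after `u`, seen from the end `l.2`, the value lies between the two. -/
structure Forced (R : RootedGraph G N S) (F : (ι → G) → G) (l : S × Bool) (u v : ι) : Prop where
  ne : u ≠ v
  mem : ∀ c, IsPlacement c → IsConsecutive l c u v →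
    F (R.place c) ∈ R.ray l '' Ioo (endDist l.2 (c u).2) (endDist l.2 (c v).2)

lemma image_ray_not (i : S) (σ : Bool) (s t : ℝ) :
    R.ray (i, !σ) '' Ioo (endDist (!σ) t) (endDist (!σ) s) =
      R.ray (i, σ) '' Ioo (endDist σ s) (endDist σ t) := by
  have hray : ∀ σ : Bool, R.ray (i, σ) = R.edge (Sum.inr i) ∘ endDist σ := fun _ => rfl
  have htrue : ∀ J : Set ℝ, endDist true '' J = J := image_id
  have hfalse : ∀ a b, endDist false '' Ioo a b = Ioo (1 - b) (1 - a) := image_const_sub_Ioo 1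
  rw [hray, hray, image_comp, image_comp]
  cases σ <;> simp only [Bool.not_true, Bool.not_false, htrue, hfalse, endDist_true, endDist_false,
    sub_sub_cancel]

lemma Forced.flip {i : S} {σ : Bool} (h : R.Forced F (i, σ) u v) : R.Forced F (i, !σ) v u where
  ne := h.ne.symm
  mem c hc hcons := by
    rw [image_ray_not]
    exact h.mem c hc (by simpa using hcons.flip)

lemma reach_parked [DecidableEq ι] [Finite ι] {i k : S} {ρ : ι → ℝ} (hki : k ≠ i)
    (hρ : Function.Injective ρ) (hρ1 : ∀ j, ρ j ∈ Ioo (0 : ℝ) 1) (hc : IsPlacement c)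
    (h : IsConsecutive (i, true) c u v) :
    R.Reach (arc i (c u).2 (c v).2) c (parked i k ρ u v ((c u).2, (c v).2)) := by
  refine reach_of_eq_on_arc hki (hc.mem u).1 h.lt.le (hc.mem v).2 hc
    (isPlacement_parked hki hρ hρ1 (h.mem_orderedParams hc)) fun j hj => ?_
  by_cases hju : j = u
  · rw [hju, parked_left]
    exact Prod.ext h.fst_left rfl
  by_cases hjv : j = v
  · rw [hjv, parked_right h.ne]
    exact Prod.ext h.fst_right rfl
  rcases hj with hj | hj
  · exact absurd hj (h.notMem j hju hjv)
  · rw [parked_of_ne hju hjv] at hj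
    exact absurd hj.1 hki

variable [T2Space G] [Finite N] [Finite S]

lemma Slide.map_mem_image_edge (hF : AvoidsTokens F) {i : S} {s t : ℝ} (hs : 0 < s) (ht : t < 1)
    (h : R.Slide (arc i s t) c c') (hu : c u = (i, s)) (hv : c v = (i, t))
    (hmem : F (R.place c) ∈ R.edge (Sum.inr i) '' Ioo s t) :
    F (R.place c') ∈ R.edge (Sum.inr i) '' Ioo s t := by
  classical
  obtain ⟨hc, -, j, hj, C, hC, hcC, hcC', hA⟩ := h
  have hst : s ≤ t := by
    obtain ⟨z, hz, -⟩ := hmem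
    exact (hz.1.trans hz.2).le
  have hne : ∀ w, c w ∈ arc i s t → w ≠ j := by
    rintro w hw rfl
    exact hA _ (Or.inl hw) hcC
  have hinj : ∀ y ∈ C, Function.Injective (Function.update (R.place c) j y) := fun y hy =>
    injective_update_of_forall_ne (R.place_injective hc).injOn fun k hk h =>
      hA (c k) (Or.inr ⟨k, hk, rfl⟩) (by rw [← h] at hy; exact hy)
  have hplace : ∀ w, c w ∈ arc i s t → ∀ y : G,
      Function.update (R.place c) j y w = R.edge (Sum.inr (c w).1) (c w).2 := fun w hw y =>
    Function.update_of_ne (hne w hw) ..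
  have hcont : Continuous fun y : C => F (Function.update (R.place c) j y) :=
    continuousOn_iff_continuous_domRestrict.1
      (hF.continuousOn.comp (Continuous.continuousOn (by fun_prop)) hinj)
  have hupdate : Function.update (R.place c) j (R.place c' j) = R.place c' :=
    Function.update_eq_iff.2 ⟨rfl, fun k hk => congr_arg R.point (hj k hk)⟩
  have := isPreconnected_iff_preconnectedSpace.1 hC
  rw [← hupdate]
  refine R.mem_image_Ioo_of_preconnectedSpace (Sum.inr i) hcont continuous_const continuous_const
    (fun _ => hs.le) (fun _ => ht.le) (fun y => ?_) (fun y => ?_) (z := ⟨_, hcC⟩)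
    (z' := ⟨_, hcC'⟩) (by rwa [Function.update_eq_self])
  · simpa only [hplace u (by rw [hu]; exact ⟨rfl, le_rfl, hst⟩), hu] using hF.ne _ (hinj y y.2) u
  · simpa only [hplace v (by rw [hv]; exact ⟨rfl, hst, le_rfl⟩), hv] using hF.ne _ (hinj y y.2) v

lemma Reach.map_mem_image_edge (hF : AvoidsTokens F) {i : S} {s t : ℝ} (hs : 0 < s) (hst : s ≤ t)
    (ht : t < 1) (h : R.Reach (arc i s t) c c') (hu : c u = (i, s)) (hv : c v = (i, t))
    (hmem : F (R.place c) ∈ R.edge (Sum.inr i) '' Ioo s t) :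
    F (R.place c') ∈ R.edge (Sum.inr i) '' Ioo s t := by
  induction h with
  | refl => exact hmem
  | tail hreach hslide ih =>
    have hu' := Reach.apply_eq hreach (j := u) (by rw [hu]; exact ⟨rfl, le_rfl, hst⟩)
    have hv' := Reach.apply_eq hreach (j := v) (by rw [hv]; exact ⟨rfl, hst, le_rfl⟩)
    exact Slide.map_mem_image_edge hF hs ht hslide (hu'.trans hu) (hv'.trans hv) ih

section Parked

variable [DecidableEq ι] {i k : S} {ρ : ι → ℝ}

lemma map_parked_mem_image_edge (hF : AvoidsTokens F) (hki : k ≠ i) (hρ : Function.Injective ρ)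
    (hρ1 : ∀ j, ρ j ∈ Ioo (0 : ℝ) 1) (huv : u ≠ v) {p q : ℝ × ℝ} (hp : p ∈ orderedParams)
    (hq : q ∈ orderedParams)
    (hmem : F (R.place (parked i k ρ u v p)) ∈ R.edge (Sum.inr i) '' Ioo p.1 p.2) :
    F (R.place (parked i k ρ u v q)) ∈ R.edge (Sum.inr i) '' Ioo q.1 q.2 := by
  have hinj : ∀ p ∈ orderedParams, Function.Injective (R.place (parked i k ρ u v p)) :=
    fun p hp => R.place_injective (isPlacement_parked hki hρ hρ1 hp)
  have hplace : ContinuousOn (fun p => R.place (parked i k ρ u v p)) orderedParams := by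
    refine continuousOn_pi.2 fun j => ?_
    by_cases hju : j = u
    · simp only [place, hju, parked_left, point]
      exact (R.continuousOn_edge _).comp continuousOn_fst fun p hp => Ioo_subset_Icc_self hp.1.1
    by_cases hjv : j = v
    · simp only [place, hjv, parked_right huv, point]
      exact (R.continuousOn_edge _).comp continuousOn_snd fun p hp => Ioo_subset_Icc_self hp.1.2
    · simp only [place, parked_of_ne hju hjv]
      exact continuousOn_const
  have hcont : Continuous fun p : orderedParams => F (R.place (parked i k ρ u v p)) :=
    continuousOn_iff_continuous_domRestrict.1 (hF.continuousOn.comp hplace hinj)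
  have := isPreconnected_iff_preconnectedSpace.1 isPreconnected_orderedParams
  refine R.mem_image_Ioo_of_preconnectedSpace (Sum.inr i) hcont
    (s := fun p : orderedParams => p.1.1) (t := fun p : orderedParams => p.1.2) (by fun_prop)
    (by fun_prop) (fun p => p.2.1.1.1.le) (fun p => p.2.1.2.2.le) (fun p => ?_) (fun p => ?_)
    (z := ⟨p, hp⟩) (z' := ⟨q, hq⟩) hmem
  · simpa only [place, point, parked_left] using hF.ne _ (hinj p p.2) u
  · simpa only [place, point, parked_right huv] using hF.ne _ (hinj p p.2) v

end Parked

-- Any two placements in which `u` and `v` are consecutive can be deformed into each other by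
-- parking the other tokens on another edge, while `F` cannot cross `u` and `v`.
lemma forced_true_of_mem [Nontrivial S] [Finite ι] (hF : AvoidsTokens F) {i : S}
    (hc : IsPlacement c) (h : IsConsecutive (i, true) c u v)
    (hmem : F (R.place c) ∈ R.edge (Sum.inr i) '' Ioo (c u).2 (c v).2) :
    R.Forced F (i, true) u v := by
  classical
  obtain ⟨k, hki⟩ := exists_ne i
  obtain ⟨ρ, hρ, hρ1, -⟩ := exists_injective_mem_Ioo_of_priority (fun _ : ι => 0)
  refine ⟨h.ne, fun c' hc' h' => ?_⟩
  have hparked := (reach_parked hki hρ hρ1 hc h).map_mem_image_edge hF (hc.mem u).1 h.lt.le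
    (hc.mem v).2 (Prod.ext h.fst_left rfl) (Prod.ext h.fst_right rfl) hmem
  have hparked' := map_parked_mem_image_edge hF hki hρ hρ1 h.ne (h.mem_orderedParams hc)
    (h'.mem_orderedParams hc') hparked
  exact (reach_parked hki hρ hρ1 hc' h').symm.map_mem_image_edge hF (hc'.mem u).1 h'.lt.le
    (hc'.mem v).2 (parked_left _) (parked_right h.ne _) hparked'

lemma forced_of_mem [Nontrivial S] [Finite ι] (hF : AvoidsTokens F) {l : S × Bool}
    (hc : IsPlacement c) (h : IsConsecutive l c u v)
    (hmem : F (R.place c) ∈ R.ray l '' Ioo (endDist l.2 (c u).2) (endDist l.2 (c v).2)) :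
    R.Forced F l u v := by
  obtain ⟨i, _ | _⟩ := l
  · exact (forced_true_of_mem hF hc h.flip (by rwa [← image_ray_not] at hmem)).flip
  · exact forced_true_of_mem hF hc h hmem

end RootedGraph

section Cuts

variable {S ι : Type*} {c : ι → S × ℝ} {m : ι} {outer : S × Bool → ι}

/-- The distance of the token `outer l` from the end `l.2` of the edge `l.1`. -/
def outerDist (c : ι → S × ℝ) (outer : S × Bool → ι) (l : S × Bool) : ℝ :=
  endDist l.2 (c (outer l)).2

/-- The tokens other than `m` occupy every non-tree edge, and `outer l` is the one on the edge `l.1`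
which is closest to the end `l.2`. Cutting the edges at these tokens leaves a tree in which `m` can
move freely; the position of `m` in `c` is irrelevant. -/
structure IsCut (c : ι → S × ℝ) (m : ι) (outer : S × Bool → ι) : Prop extends IsPlacement c where
  outer_ne : ∀ l, outer l ≠ m
  fst_outer : ∀ l, (c (outer l)).1 = l.1
  le : ∀ l, ∀ j ≠ m, (c j).1 = l.1 → outerDist c outer l ≤ endDist l.2 (c j).2

lemma IsPlacement.exists_isCut [Finite ι] (hc : IsPlacement c) (h : ∀ i, ∃ j ≠ m, (c j).1 = i) :
    ∃ outer, IsCut c m outer := by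
  have hmin : ∀ l : S × Bool, ∃ j, (j ≠ m ∧ (c j).1 = l.1) ∧
      ∀ k, k ≠ m ∧ (c k).1 = l.1 → endDist l.2 (c j).2 ≤ endDist l.2 (c k).2 := fun l =>
    exists_min_image {j | j ≠ m ∧ (c j).1 = l.1} (fun j => endDist l.2 (c j).2) (toFinite _) (h l.1)
  choose outer houter hle using hmin
  exact ⟨outer, hc, fun l => (houter l).1, fun l => (houter l).2,
    fun l j hj hjl => hle l j ⟨hj, hjl⟩⟩

namespace IsCut

variable (h : IsCut c m outer)

include h

lemma isCutDepth : IsCutDepth (outerDist c outer) where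
  pos l := (endDist_mem_Ioo (h.mem _)).1
  add_le_one i := by
    have hle := h.le (i, true) (outer (i, false)) (h.outer_ne _) (h.fst_outer _)
    simp only [outerDist, endDist_true, endDist_false] at hle ⊢
    linarith

variable [DecidableEq ι] {l : S × Bool} {t : ℝ}

lemma isPlacement_update (ht : t ∈ Ioo 0 (outerDist c outer l)) :
    IsPlacement (Function.update c m (l.1, endDist l.2 t)) := by
  refine h.toIsPlacement.update (endDist_mem_Ioo (h.isCutDepth.Ioo_subset l ht)) fun k hk hkt => ?_
  have hle := h.le l k hk (by rw [hkt])
  rw [hkt, endDist_endDist] at hle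
  exact ht.2.not_ge hle

lemma update_outer (z : S × ℝ) : Function.update c m z (outer l) = c (outer l) :=
  Function.update_of_ne (h.outer_ne l) ..

lemma isConsecutive_update (ht : t ∈ Ioo 0 (outerDist c outer l)) :
    IsConsecutive l (Function.update c m (l.1, endDist l.2 t)) m (outer l) where
  fst_left := by rw [Function.update_self]
  fst_right := by rw [h.update_outer, h.fst_outer]
  lt := by
    rw [Function.update_self, h.update_outer, endDist_endDist]
    exact ht.2
  notMem j hjm hj := by
    rw [Function.update_of_ne hjm, h.update_outer]
    rintro ⟨hjl, -, hle⟩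
    exact hj (h.injective (Prod.ext (hjl.trans (h.fst_outer l).symm)
      (endDist_injective _ (le_antisymm hle (h.le l j hjm hjl)))))

end IsCut

end Cuts

namespace RootedGraph

variable {G : Type*} [TopologicalSpace G] {N S ι : Type*} {R : RootedGraph G N S}
  {F : (ι → G) → G} {c : ι → S × ℝ} {m : ι} {outer : S × Bool → ι} {l : S × Bool}

lemma ray_inj {l l' : S × Bool} {t t' : ℝ} (ht : t ∈ Ioo (0 : ℝ) 1) (ht' : t' ∈ Ioo (0 : ℝ) 1)
    (h : R.ray l t = R.ray l' t') : l.1 = l'.1 ∧ endDist l.2 t = endDist l'.2 t' :=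
  (R.edge_inj (endDist_mem_Ioo ht) (endDist_mem_Ioo ht') h).imp_left (Sum.inr.inj ·)

lemma place_notMem_cutTree (h : IsCut c m outer) {j : ι} (hj : j ≠ m) :
    R.place c j ∉ R.cutTree (outerDist c outer) := by
  rw [place, point, R.edge_inr_mem_cutTree_iff h.isCutDepth _ (Ioo_subset_Icc_self (h.mem j))]
  rintro ⟨σ, hσ⟩
  exact hσ.not_ge (h.le (_, σ) j hj rfl)

section Moving

variable [DecidableEq ι]

/-- The value of `F` as a function of the point at which the token `m` is put, the other tokens
being fixed. -/
def moving (R : RootedGraph G N S) (F : (ι → G) → G) (c : ι → S × ℝ) (m : ι) (y : G) : G :=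
  F (Function.update (R.place c) m y)

lemma moving_ray (t : ℝ) : R.moving F c m (R.ray l t) =
    F (R.place (Function.update c m (l.1, endDist l.2 t))) :=
  congr_arg F (Function.comp_update R.point c m (l.1, endDist l.2 t)).symm

lemma injective_update_place (h : IsCut c m outer) {y : G}
    (hy : y ∈ R.cutTree (outerDist c outer)) :
    Function.Injective (Function.update (R.place c) m y) :=
  injective_update_of_forall_ne (R.place_injective h.toIsPlacement).injOn fun _ hk hky =>
    place_notMem_cutTree h hk (hky ▸ hy)

lemma continuousOn_moving (hF : AvoidsTokens F) (h : IsCut c m outer) :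
    ContinuousOn (R.moving F c m) (R.cutTree (outerDist c outer)) :=
  hF.continuousOn.comp (Continuous.continuousOn (by fun_prop)) fun _ hy =>
    injective_update_place h hy

lemma moving_ne (hF : AvoidsTokens F) (h : IsCut c m outer) {y : G}
    (hy : y ∈ R.cutTree (outerDist c outer)) : R.moving F c m y ≠ y := by
  simpa only [moving, Function.update_self] using hF.ne _ (injective_update_place h hy) m

lemma moving_ne_place (hF : AvoidsTokens F) (h : IsCut c m outer) {y : G}
    (hy : y ∈ R.cutTree (outerDist c outer)) {j : ι} (hj : j ≠ m) :
    R.moving F c m y ≠ R.place c j := by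
  simpa only [moving, Function.update_of_ne hj] using hF.ne _ (injective_update_place h hy) j

lemma pointsOutward_of_forced (h : IsCut c m outer) (hl : R.Forced F l m (outer l)) :
    R.PointsOutward (outerDist c outer) (R.moving F c m) l := by
  intro t ht
  obtain ⟨u, hu, hFu⟩ := hl.mem _ (h.isPlacement_update ht) (h.isConsecutive_update ht)
  rw [Function.update_self, endDist_endDist, h.update_outer] at hu
  exact ⟨u, hu, (moving_ray t).trans hFu.symm⟩

/-- The value of `F` stays between the outermost tokens of the edge `i` while `m` moves in the
cut tree. -/
def Trapped (R : RootedGraph G N S) (F : (ι → G) → G) (c : ι → S × ℝ) (m : ι)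
    (outer : S × Bool → ι) (i : S) : Prop :=
  MapsTo (R.moving F c m) (R.cutTree (outerDist c outer))
    (R.edge (Sum.inr i) '' Ioo (c (outer (i, true))).2 (c (outer (i, false))).2)

lemma Trapped.not_pointsOutward (h : IsCut c m outer) {i : S} (hi : R.Trapped F c m outer i) :
    ¬ R.PointsOutward (outerDist c outer) (R.moving F c m) l := by
  intro hl
  have hr := h.isCutDepth
  have hpos := hr.pos l
  obtain ⟨u, hu, heq⟩ := hl (outerDist c outer l / 2) ⟨half_pos hpos, half_lt_self hpos⟩
  have hmem := hi (R.ray_mem_cutTree hr l ⟨(half_pos hpos).le, half_lt_self hpos⟩)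
  have hcut := R.ray_mem_cutTree hr l ⟨((half_pos hpos).trans hu.1).le, hu.2⟩
  rw [heq] at hmem
  refine hcut i (image_mono ?_ hmem)
  simp only [outerDist, endDist_true, endDist_false, sub_sub_cancel]
  exact Ioo_subset_Icc_self

variable [T2Space G] [Finite N] [Finite S]

lemma forced_of_pointsOutward [Nontrivial S] [Finite ι] (hF : AvoidsTokens F)
    (h : IsCut c m outer) (hl : R.PointsOutward (outerDist c outer) (R.moving F c m) l) :
    R.Forced F l m (outer l) := by
  have hpos := h.isCutDepth.pos l
  have ht : outerDist c outer l / 2 ∈ Ioo 0 (outerDist c outer l) :=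
    ⟨half_pos hpos, half_lt_self hpos⟩
  obtain ⟨u, hu, hFu⟩ := hl _ ht
  refine forced_of_mem hF (h.isPlacement_update ht) (h.isConsecutive_update ht) ?_
  rw [Function.update_self, endDist_endDist, h.update_outer]
  exact ⟨u, hu, ((moving_ray _).symm.trans hFu).symm⟩

lemma fixedPointFreeOn_or_trapped (hF : AvoidsTokens F) (h : IsCut c m outer) :
    FixedPointFreeOn (R.moving F c m) (R.cutTree (outerDist c outer)) ∨
      ∃ i, R.Trapped F c m outer i := by
  by_cases hmaps : MapsTo (R.moving F c m) (R.cutTree (outerDist c outer))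
    (R.cutTree (outerDist c outer))
  · exact Or.inl ⟨continuousOn_moving hF h, hmaps, fun _ => moving_ne hF h⟩
  right
  simp only [MapsTo, not_forall] at hmaps
  obtain ⟨y, hy, hyout⟩ := hmaps
  simp only [cutTree, mem_ofPred_eq, not_forall, not_not] at hyout
  obtain ⟨i, t, ht, hty⟩ := hyout
  have houter : ∀ (σ : Bool) {z}, z ∈ R.cutTree (outerDist c outer) →
      R.moving F c m z ≠ R.edge (Sum.inr i) (c (outer (i, σ))).2 := by
    intro σ z hz
    simpa only [place, point, h.fst_outer] using moving_ne_place hF h hz (h.outer_ne (i, σ))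
  simp only [outerDist, endDist_true, endDist_false, sub_sub_cancel] at ht
  have htIoo : t ∈ Ioo (c (outer (i, true))).2 (c (outer (i, false))).2 :=
    ⟨ht.1.lt_of_ne fun heq => houter true hy (by rw [heq, hty]),
      ht.2.lt_of_ne fun heq => houter false hy (by rw [← heq, hty])⟩
  have := isPreconnected_iff_preconnectedSpace.1 (R.isPreconnected_cutTree h.isCutDepth)
  exact ⟨i, fun z hz => R.mem_image_Ioo_of_preconnectedSpace (Sum.inr i)
    (continuousOn_iff_continuous_domRestrict.1 (continuousOn_moving hF h)) continuous_const
    continuous_const (fun _ => (h.mem _).1.le) (fun _ => (h.mem _).2.le)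
    (fun z => houter true z.2) (fun z => houter false z.2) (z := ⟨y, hy⟩) (z' := ⟨z, hz⟩)
    ⟨t, htIoo, hty⟩⟩

lemma pointsOutward_unique (hF : AvoidsTokens F) (h : IsCut c m outer) {l l' : S × Bool}
    (hl : R.PointsOutward (outerDist c outer) (R.moving F c m) l)
    (hl' : R.PointsOutward (outerDist c outer) (R.moving F c m) l') : l = l' := by
  rcases fixedPointFreeOn_or_trapped (R := R) hF h with hg | ⟨i, hi⟩
  · exact (existsUnique_pointsOutward h.isCutDepth hg).unique hl hl'
  · exact absurd hl (hi.not_pointsOutward h)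

end Moving

/-- In one of the two directions of the edge `i`, the value of `F` is trapped between `u` and `v`
whenever `v` comes directly after `u`. -/
def ForcedPair (R : RootedGraph G N S) (F : (ι → G) → G) (i : S) (u v : ι) : Prop :=
  ∃ σ, R.Forced F (i, σ) u v

lemma ForcedPair.symm {i : S} {u v : ι} (h : R.ForcedPair F i u v) : R.ForcedPair F i v u :=
  h.imp' _ fun _ => Forced.flip

lemma ForcedPair.forced_or {i : S} {u v : ι} (h : R.ForcedPair F i u v) (σ : Bool) :
    R.Forced F (i, σ) u v ∨ R.Forced F (i, σ) v u := by
  obtain ⟨τ, hτ⟩ := h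
  rcases Bool.eq_or_eq_not σ τ with rfl | rfl
  exacts [Or.inl hτ, Or.inr hτ.flip]

variable [T2Space G] [Finite N] [Finite S] [Nontrivial S] [Finite ι]

lemma Trapped.exists_forcedPair [DecidableEq ι] (hF : AvoidsTokens F) (h : IsCut c m outer) {i : S}
    (hi : R.Trapped F c m outer i) :
    ∃ u v, R.ForcedPair F i u v ∧ (u = m ∨ (c u).1 = i) ∧ (v = m ∨ (c v).1 = i) := by
  have hpos := h.isCutDepth.pos (i, true)
  have ht : outerDist c outer (i, true) / 2 ∈ Ioo 0 (outerDist c outer (i, true)) :=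
    ⟨half_pos hpos, half_lt_self hpos⟩
  obtain ⟨z, hz, hzF⟩ := hi (R.ray_mem_cutTree h.isCutDepth _ (Ioo_subset_Ico_self ht))
  rw [moving_ray] at hzF
  set d := Function.update c m (i, endDist true (outerDist c outer (i, true) / 2)) with hd
  have hplace : IsPlacement d := h.isPlacement_update ht
  have hfst : ∀ k, (d k).1 = i → k = m ∨ (c k).1 = i := by
    intro k hk
    by_cases hkm : k = m
    · exact Or.inl hkm
    · exact Or.inr (by rwa [hd, Function.update_of_ne hkm] at hk)
  have hzd : ∀ j, d j ≠ (i, z) := by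
    intro j hj
    refine hF.ne _ (R.place_injective hplace) j ?_
    rw [← hzF, place, hj, point]
  have houter : ∀ σ, d (outer (i, σ)) = c (outer (i, σ)) := fun σ => h.update_outer _
  obtain ⟨u, v, huv, hzuv⟩ := exists_isConsecutive_mem_Ioo hplace.injective hzd
    (a := outer (i, true)) (b := outer (i, false)) (by rw [houter, h.fst_outer])
    (by rw [houter, h.fst_outer]) (by rw [houter]; exact hz.1) (by rw [houter]; exact hz.2)
  exact ⟨u, v, ⟨true, forced_of_mem hF hplace huv ⟨z, hzuv, hzF⟩⟩, hfst u huv.fst_left,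
    hfst v huv.fst_right⟩

lemma exists_forcedPair (hF : AvoidsTokens F) (h : IsCut c m outer) :
    ∃ i u v, R.ForcedPair F i u v ∧ (u = m ∨ (c u).1 = i) ∧ (v = m ∨ (c v).1 = i) := by
  classical
  rcases fixedPointFreeOn_or_trapped (R := R) hF h with hg | ⟨i, hi⟩
  · obtain ⟨l, hl, -⟩ := existsUnique_pointsOutward h.isCutDepth hg
    exact ⟨l.1, m, outer l, ⟨l.2, forced_of_pointsOutward hF h hl⟩, Or.inl rfl,
      Or.inr (h.fst_outer l)⟩
  · exact ⟨i, hi.exists_forcedPair hF h⟩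

end RootedGraph

-- The tokens other than `a` and `m` suffice for the labels other than `i`.
lemma exists_labels {S ι : Type*} [Finite S] [Finite ι] (hcard : Nat.card S + 1 ≤ Nat.card ι)
    {i j : S} (hij : i ≠ j) {a w m : ι} (haw : a ≠ w) (ham : a ≠ m) (hwm : w ≠ m) :
    ∃ κ : ι → S, κ a = i ∧ κ w = j ∧ (∀ k ≠ a, κ k ≠ i) ∧ ∀ s, ∃ k ≠ m, κ k = s := by
  classical
  have := Fintype.ofFinite ι
  have := Fintype.ofFinite S
  have hle : Fintype.card {s // s ∉ ({i} : Finset S)} ≤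
      Fintype.card {k // k ∉ ({a, m} : Finset ι)} := by
    rw [Fintype.card_subtype_compl, Fintype.card_coe, Finset.card_singleton,
      Fintype.card_subtype_compl, Fintype.card_coe, Finset.card_pair ham]
    rw [Nat.card_eq_fintype_card, Nat.card_eq_fintype_card] at hcard
    omega
  obtain ⟨e₀⟩ := Function.Embedding.nonempty_of_card_le hle
  let j' : {s // s ∉ ({i} : Finset S)} := ⟨j, by simpa using hij.symm⟩
  let e := (e₀.setValue j' ⟨w, by simp [haw.symm, hwm]⟩).trans (Function.Embedding.subtype _)
  have : Nonempty {s // s ∉ ({i} : Finset S)} := ⟨j'⟩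
  have hew : e j' = w := congr_arg Subtype.val (e₀.setValue_eq _ _)
  have he : ∀ s, e s ≠ a ∧ e s ≠ m := fun s => by
    have hs : e s ∉ ({a, m} : Finset ι) := (e₀.setValue j' _ s).2
    simpa only [Finset.mem_insert, Finset.mem_singleton, not_or] using hs
  have hinv : ∀ s, Function.invFun e (e s) = s := Function.leftInverse_invFun e.injective
  refine ⟨fun k => if k = a then i else (Function.invFun e k).1, if_pos rfl, ?_, fun k hk => ?_,
    fun s => ?_⟩
  · rw [← hew]
    exact (if_neg (he j').1).trans (by rw [hinv])
  · simp only [if_neg hk]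
    simpa using (Function.invFun e k).2
  · by_cases hs : s = i
    · exact ⟨a, ham, (if_pos rfl).trans hs.symm⟩
    · let s' : {s // s ∉ ({i} : Finset S)} := ⟨s, by simpa using hs⟩
      exact ⟨e s', (he s').2, (if_neg (he s').1).trans (by rw [hinv])⟩

section LineUp

variable {S ι : Type*}

/-- The token `k` is placed on the edge `κ k`, at the distance `ρ k` from the end chosen by `τ`. -/
def lineUp (τ : S → Bool) (κ : ι → S) (ρ : ι → ℝ) (k : ι) : S × ℝ :=
  (κ k, endDist (τ (κ k)) (ρ k))

variable {τ : S → Bool} {κ : ι → S} {ρ : ι → ℝ} {i : S} {σ : Bool} {u v : ι}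

lemma endDist_lineUp (k : ι) : endDist (τ (κ k)) (lineUp τ κ ρ k).2 = ρ k := endDist_endDist _ _

lemma isPlacement_lineUp (hρ : Function.Injective ρ) (hρ1 : ∀ k, ρ k ∈ Ioo (0 : ℝ) 1) :
    IsPlacement (lineUp τ κ ρ) where
  injective k k' h := by
    have hκ : κ k = κ k' := congr_arg Prod.fst h
    apply hρ
    rw [← endDist_lineUp (τ := τ) (κ := κ) (ρ := ρ) k, h, hκ, endDist_lineUp]
  mem k := endDist_mem_Ioo (hρ1 k)

lemma isConsecutive_lineUp (hτ : τ i = σ) (hu : κ u = i) (hv : κ v = i) (huv : ρ u < ρ v)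
    (h : ∀ k, k ≠ u → k ≠ v → κ k = i → ρ k ∉ Icc (ρ u) (ρ v)) :
    IsConsecutive (i, σ) (lineUp τ κ ρ) u v := by
  have hdist : ∀ k, κ k = i → endDist σ (lineUp τ κ ρ k).2 = ρ k := by
    rintro k rfl
    rw [← hτ, endDist_lineUp]
  refine ⟨hu, hv, by rwa [hdist u hu, hdist v hv], fun k hku hkv ⟨hk, hmem⟩ => ?_⟩
  simp only [hdist u hu, hdist v hv, hdist k hk] at hmem
  exact h k hku hkv hk hmem

end LineUp

namespace RootedGraph

variable {G : Type*} [TopologicalSpace G] {N S ι : Type*} {R : RootedGraph G N S}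
  {F : (ι → G) → G} {i j : S}

lemma ForcedPair.ne {u v : ι} (h : R.ForcedPair F i u v) : u ≠ v := h.elim fun _ h => h.ne

lemma Forced.exists_lineUp_eq {τ : S → Bool} {κ : ι → S} {ρ : ι → ℝ} {σ : Bool} {u v : ι}
    (h : R.Forced F (i, σ) u v) (hρ : Function.Injective ρ) (hρ1 : ∀ k, ρ k ∈ Ioo (0 : ℝ) 1)
    (hτ : τ i = σ) (hu : κ u = i) (hv : κ v = i) (huv : ρ u < ρ v)
    (hbetween : ∀ k, k ≠ u → k ≠ v → κ k = i → ρ k ∉ Icc (ρ u) (ρ v)) :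
    ∃ x ∈ Ioo (ρ u) (ρ v), x ∈ Ioo (0 : ℝ) 1 ∧
      R.ray (i, σ) x = F (R.place (lineUp τ κ ρ)) := by
  obtain ⟨x, hx, hxF⟩ := h.mem _ (isPlacement_lineUp (τ := τ) (κ := κ) hρ hρ1)
    (isConsecutive_lineUp hτ hu hv huv hbetween)
  simp only [lineUp, hu, hv, hτ, endDist_endDist] at hx
  exact ⟨x, hx, ⟨(hρ1 u).1.trans hx.1, hx.2.trans (hρ1 v).2⟩, hxF⟩

lemma Forced.not_forced_of_chain [Finite ι] {l : S × Bool} {u v w : ι} (h : R.Forced F l u v)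
    (huw : u ≠ w) : ¬ R.Forced F l v w := by
  classical
  intro h'
  obtain ⟨ρ, hρ, hρ1, hord⟩ := exists_injective_mem_Ioo_of_priority (fun k : ι =>
    if k = u then 0 else if k = v then 1 else if k = w then 2 else 3)
  have huv : ρ u < ρ v := hord u v (by simp [h.ne.symm])
  have hvw : ρ v < ρ w := hord v w (by simp [h.ne.symm, huw.symm, h'.ne.symm])
  obtain ⟨x, hx, hx1, hxF⟩ := h.exists_lineUp_eq (τ := fun _ => l.2) (κ := fun _ => l.1) hρ hρ1 rfl
    rfl rfl huv fun k hku hkv _ hk => hk.2.not_gt (hord v k (by grind))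
  obtain ⟨y, hy, hy1, hyF⟩ := h'.exists_lineUp_eq (τ := fun _ => l.2) (κ := fun _ => l.1) hρ hρ1 rfl
    rfl rfl hvw fun k hkv hkw _ hk => by
      by_cases hku : k = u
      · exact hk.1.not_gt (hku ▸ huv)
      · exact hk.2.not_gt (hord w k (by grind))
  have hxy := endDist_injective _ (ray_inj hx1 hy1 (hxF.trans hyF.symm)).2
  linarith [hx.2, hy.1]

lemma ForcedPair.not_forcedPair_of_disjoint [Finite ι] {a b u v : ι} (h : R.ForcedPair F i a b)
    (hij : i ≠ j) (hau : a ≠ u) (hav : a ≠ v) (hbu : b ≠ u) (hbv : b ≠ v) :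
    ¬ R.ForcedPair F j u v := by
  classical
  rintro ⟨σ', h'⟩
  obtain ⟨σ, h⟩ := h
  obtain ⟨ρ, hρ, hρ1, hord⟩ := exists_injective_mem_Ioo_of_priority (fun k : ι =>
    if k = a ∨ k = u then 0 else if k = b ∨ k = v then 1 else 2)
  obtain ⟨x, -, hx1, hxF⟩ := h.exists_lineUp_eq (τ := fun s => if s = i then σ else σ')
    (κ := fun k => if k = a ∨ k = b then i else j) hρ hρ1 (if_pos rfl) (by simp) (by simp)
    (hord a b (by simp [h.ne.symm, hbu])) fun k hka hkb hk => absurd hk (by simp [*, hij.symm])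
  obtain ⟨y, -, hy1, hyF⟩ := h'.exists_lineUp_eq (τ := fun s => if s = i then σ else σ')
    (κ := fun k => if k = a ∨ k = b then i else j) hρ hρ1 (if_neg hij.symm)
    (by simp [hau.symm, hbu.symm]) (by simp [hav.symm, hbv.symm])
    (hord u v (by simp [hav.symm, h'.ne.symm])) fun k hku hkv hk hmem =>
      hmem.2.not_gt (hord v k (by grind))
  exact hij (ray_inj hx1 hy1 (hxF.trans hyF.symm)).1

variable [T2Space G] [Finite N] [Finite S] [Finite ι]

-- With `b` moving, `a` alone on the edge `i` and `w` closest to one end of the edge `j`, two ends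
-- of the cut tree would be pointed at.
lemma ForcedPair.not_forcedPair_of_common (hF : AvoidsTokens F)
    (hcard : Nat.card S + 1 ≤ Nat.card ι) {a b w : ι} (h : R.ForcedPair F i b a) (hij : i ≠ j)
    (haw : a ≠ w) : ¬ R.ForcedPair F j b w := by
  classical
  rintro ⟨σ', h'⟩
  obtain ⟨σ, h⟩ := h
  obtain ⟨κ, -, hκw, hκi, hκ⟩ := exists_labels hcard hij haw h.ne.symm h'.ne.symm
  obtain ⟨ρ, hρ, hρ1, hord⟩ :=
    exists_injective_mem_Ioo_of_priority (fun k : ι => if k = w then 0 else 1)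
  obtain ⟨outer, hcut⟩ :=
    (isPlacement_lineUp (τ := fun _ => σ') (κ := κ) hρ hρ1).exists_isCut hκ
  have houter : outer (i, σ) = a := by_contra fun hne => hκi _ hne (hcut.fst_outer _)
  have houter' : outer (j, σ') = w := by
    by_contra hne
    have hle := hcut.le (j, σ') w h'.ne.symm hκw
    simp only [outerDist, lineUp, endDist_endDist] at hle
    exact hle.not_gt (hord _ _ (by simp [hne]))
  have heq := pointsOutward_unique hF hcut (pointsOutward_of_forced hcut (houter.symm ▸ h))
    (pointsOutward_of_forced hcut (houter'.symm ▸ h'))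
  exact hij (congr_arg Prod.fst heq)

variable [Nontrivial S]

lemma exists_forcedPair_of_labels (hF : AvoidsTokens F) {κ : ι → S} {m : ι}
    (hκ : ∀ s, ∃ k ≠ m, κ k = s) :
    ∃ i u v, R.ForcedPair F i u v ∧ (u = m ∨ κ u = i) ∧ (v = m ∨ κ v = i) := by
  obtain ⟨ρ, hρ, hρ1, -⟩ := exists_injective_mem_Ioo_of_priority (fun _ : ι => 0)
  obtain ⟨outer, hcut⟩ :=
    (isPlacement_lineUp (τ := fun _ => true) (κ := κ) hρ hρ1).exists_isCut hκ
  exact exists_forcedPair hF hcut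

-- No pair on another edge is forced, and with `a` alone on the edge `i` only `a` and `m` can form a
-- forced pair on it.
lemma ForcedPair.forcedPair_third (hF : AvoidsTokens F) (hcard : Nat.card S + 1 ≤ Nat.card ι)
    {a b m : ι} (h : R.ForcedPair F i a b) (ham : a ≠ m) (hbm : b ≠ m) :
    R.ForcedPair F i a m := by
  obtain ⟨j, hji⟩ := exists_ne i
  obtain ⟨κ, hκa, -, hκi, hκ⟩ := exists_labels hcard hji.symm h.ne ham hbm
  obtain ⟨i', u, v, h', hu, hv⟩ := exists_forcedPair_of_labels (R := R) hF hκ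
  have halone : ∀ k, κ k = i → k = a := fun k hk => by_contra fun hka => hκi k hka hk
  by_cases hi : i = i'
  · subst hi
    rcases hu.imp_right (halone u) with rfl | rfl <;> rcases hv.imp_right (halone v) with rfl | rfl
    · exact absurd rfl h'.ne
    · exact h'.symm
    · exact h'
    · exact absurd rfl h'.ne
  have haway : ∀ k, k = m ∨ κ k = i' → a ≠ k := by
    rintro _ (rfl | hk) rfl
    exacts [ham rfl, hi (hκa.symm.trans hk)]
  by_cases hbu : b = u
  · subst hbu
    exact absurd h' (h.symm.not_forcedPair_of_common hF hcard hi (haway v hv))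
  by_cases hbv : b = v
  · subst hbv
    exact absurd h'.symm (h.symm.not_forcedPair_of_common hF hcard hi (haway u hu))
  exact absurd h' (h.not_forcedPair_of_disjoint hi (haway u hu) (haway v hv) hbu hbv)

-- All pairs of three tokens are forced on one edge. Each of them is forced in one of the two
-- orders, and any choice of these orders contains a chain.
theorem not_avoidsTokens (R : RootedGraph G N S) (F : (ι → G) → G)
    (hcard : Nat.card S + 1 ≤ Nat.card ι) : ¬ AvoidsTokens F := by
  intro hF
  classical
  have := Fintype.ofFinite ι
  have hcard_ι : 2 < Fintype.card ι := by
    have := Finite.one_lt_card (α := S)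
    rw [← Nat.card_eq_fintype_card]
    omega
  obtain ⟨x, y, z, hxy, hxz, hyz⟩ := Fintype.two_lt_card_iff.1 hcard_ι
  obtain ⟨s, s', hs⟩ := exists_pair_ne S
  obtain ⟨κ, -, -, -, hκ⟩ := exists_labels hcard hs hxy hxz hyz
  obtain ⟨i, a, b, hab, -, -⟩ := exists_forcedPair_of_labels (R := R) hF hκ
  obtain ⟨m, ham, hbm⟩ : ∃ m, a ≠ m ∧ b ≠ m := by
    have hpair : ({a, b} : Finset ι).card < Fintype.card ι := Finset.card_le_two.trans_lt hcard_ι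
    obtain ⟨m, -, hm⟩ := Finset.exists_mem_notMem_of_card_lt_card hpair
    exact ⟨m, by grind, by grind⟩
  have ham' := hab.forcedPair_third hF hcard ham hbm
  have hbm' := hab.symm.forcedPair_third hF hcard hbm ham
  have hne := hab.ne
  rcases hab.forced_or true with hab | hba
  · rcases hbm'.forced_or true with hbm' | hmb
    · exact hab.not_forced_of_chain ham hbm'
    · rcases ham'.forced_or true with ham' | hma
      · exact ham'.not_forced_of_chain hne hmb
      · exact hma.not_forced_of_chain hbm.symm hab
  · rcases ham'.forced_or true with ham' | hma
    · exact hba.not_forced_of_chain hbm ham'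
    · rcases hbm'.forced_or true with hbm' | hmb
      · exact hbm'.not_forced_of_chain hne.symm hma
      · exact hmb.not_forced_of_chain ham.symm hba

end RootedGraph

namespace GraphModel

variable {G : Type*} [TopologicalSpace G] {V E V' E' : Type*} (M : GraphModel G V E)

include M in
lemma nonempty_vertex [Nonempty G] : Nonempty V := by
  obtain ⟨x⟩ := ‹Nonempty G›
  rcases M.exists_eq x with ⟨v, -⟩ | ⟨e, -⟩
  exacts [⟨v⟩, ⟨M.src e⟩]

-- A function that is constant on the closed edges is a continuous function on `G` with values in a
-- discrete space.
lemma eq_of_forall_src_eq_tgt [T2Space G] [PreconnectedSpace G] [Finite V] [Finite E] {Y : Type*}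
    {a : V → Y} (ha : ∀ e, a (M.src e) = a (M.tgt e)) (u v : V) : a u = a v := by
  have : Inhabited Y := ⟨a u⟩
  let _ : TopologicalSpace Y := ⊥
  have : DiscreteTopology Y := ⟨rfl⟩
  have hcont : Continuous (M.lift a fun e _ => a (M.src e)) :=
    continuousOn_univ.1 <|
      M.continuousOn_lift isOpen_univ (fun _ => rfl) ha fun _ => continuousOn_const
  simpa only [M.lift_vertex] using
    PreconnectedSpace.constant inferInstance hcont (x := M.vertex u) (y := M.vertex v)

/-- The underlying simple graph, without the loops and multiple edges. -/
def toSimpleGraph : SimpleGraph V := SimpleGraph.fromRel fun u v => ∃ e, M.src e = u ∧ M.tgt e = v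

lemma connected_toSimpleGraph [T2Space G] [ConnectedSpace G] [Finite V] [Finite E] :
    M.toSimpleGraph.Connected := by
  obtain ⟨r⟩ := M.nonempty_vertex
  refine SimpleGraph.connected_iff_exists_forall_reachable _ |>.2 ⟨r, fun v => ?_⟩
  have hreach : ∀ e, M.toSimpleGraph.Reachable r (M.src e) =
      M.toSimpleGraph.Reachable r (M.tgt e) := by
    intro e
    by_cases he : M.src e = M.tgt e
    · rw [he]
    · have hadj : M.toSimpleGraph.Adj (M.src e) (M.tgt e) := ⟨he, Or.inl ⟨e, rfl, rfl⟩⟩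
      exact propext ⟨fun h => h.trans hadj.reachable, fun h => h.trans hadj.symm.reachable⟩
  exact M.eq_of_forall_src_eq_tgt hreach r v ▸ SimpleGraph.Reachable.refl r

lemma exists_parent [T2Space G] [ConnectedSpace G] [Finite V] [Finite E] {r v : V} (hv : v ≠ r) :
    ∃ e σ, M.endpoint e (!σ) = v ∧
      M.toSimpleGraph.dist (M.endpoint e σ) r < M.toSimpleGraph.dist v r := by
  obtain ⟨p, hp⟩ := M.connected_toSimpleGraph.exists_walk_length_eq_dist v r
  cases p with
  | nil => exact absurd rfl hv
  | cons hadj p =>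
    have hlt : M.toSimpleGraph.dist _ r < p.length + 1 := Nat.lt_succ_of_le (SimpleGraph.dist_le p)
    rw [SimpleGraph.Walk.length_cons] at hp
    rw [hp] at hlt
    obtain ⟨-, ⟨e, rfl, rfl⟩ | ⟨e, rfl, rfl⟩⟩ := hadj
    · exact ⟨e, false, rfl, hlt⟩
    · exact ⟨e, true, rfl, hlt⟩

/-- The same graph with renamed vertices and edges, in which the edges `e` with `σ e = false` are
traversed in the opposite direction. -/
def reindex (φ : V' ≃ V) (ψ : E' ≃ E) (σ : E' → Bool) : GraphModel G V' E' where
  vertex v := M.vertex (φ v)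
  edge e t := M.edge (ψ e) (endDist (σ e) t)
  src e := φ.symm (M.endpoint (ψ e) (σ e))
  tgt e := φ.symm (M.endpoint (ψ e) (!σ e))
  continuousOn_edge e :=
    (M.continuousOn_edge _).comp (continuous_endDist _).continuousOn fun _ ht => endDist_mem_Icc ht
  edge_zero e := by rw [M.edge_endDist_zero, φ.apply_symm_apply]
  edge_one e := by
    rw [φ.apply_symm_apply, ← M.edge_endDist_zero]
    cases σ e <;> simp [endDist]
  vertex_injective := M.vertex_injective.comp φ.injective
  edge_inj ht ht' h := by
    obtain ⟨he, hdist⟩ := M.edge_inj (endDist_mem_Ioo ht) (endDist_mem_Ioo ht') h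
    obtain rfl := ψ.injective he
    exact ⟨rfl, endDist_injective _ hdist⟩
  edge_ne_vertex ht := M.edge_ne_vertex (endDist_mem_Ioo ht)
  exists_eq x := by
    rcases M.exists_eq x with ⟨v, rfl⟩ | ⟨e, t, ht, rfl⟩
    · exact Or.inl ⟨φ.symm v, by rw [φ.apply_symm_apply]⟩
    · obtain ⟨e, rfl⟩ := ψ.surjective e
      exact Or.inr ⟨e, endDist (σ e) t, endDist_mem_Ioo ht, by rw [endDist_endDist]⟩

-- The edges from the vertices other than the root to their parents, which are closer to the root,
-- form the spanning tree.
theorem exists_rootedGraph.{u, v} {G : Type*} [TopologicalSpace G] {V : Type u} {E : Type v}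
    [T2Space G] [ConnectedSpace G] [Finite V] [Finite E] (M : GraphModel G V E) :
    ∃ (N : Type u) (S : Type v), Finite N ∧ Finite S ∧ Nonempty (RootedGraph G N S) ∧
      Nat.card V = Nat.card N + 1 ∧ Nat.card E = Nat.card N + Nat.card S := by
  classical
  obtain ⟨r⟩ := M.nonempty_vertex
  let depth := fun v => M.toSimpleGraph.dist v r
  choose τ σ hτ hdepth using fun v : {v // v ≠ r} => M.exists_parent v.2
  have hτ_inj : Function.Injective τ := by
    intro v v' h
    have hv := hτ v
    have hlt := hdepth v
    rw [h] at hv hlt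
    by_cases hσ : σ v = σ v'
    · exact Subtype.ext (by rw [← hv, hσ, hτ])
    · rw [Bool.eq_not_of_ne hσ] at hv hlt
      rw [hτ] at hlt
      rw [Bool.not_not] at hv
      exact absurd (hdepth v') (hv ▸ hlt.not_gt)
  let φ : Option {v // v ≠ r} ≃ V := Equiv.optionSubtypeNe r
  let ψ : {v // v ≠ r} ⊕ ↥(range τ)ᶜ ≃ E :=
    ((Equiv.ofInjective τ hτ_inj).sumCongr (Equiv.refl _)).trans (Equiv.Set.sumCompl (range τ))
  refine ⟨{v // v ≠ r}, ↥(range τ)ᶜ, inferInstance, inferInstance, ⟨{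
    toGraphModel := M.reindex φ ψ (Sum.elim σ fun _ => true)
    tgt_inl := fun v => φ.symm_apply_eq.2 (hτ v)
    depth := fun w => depth (φ w)
    depth_src_lt := fun v => ?_ }⟩, ?_, ?_⟩
  · change depth (φ (φ.symm (M.endpoint (τ v) (σ v)))) < depth v
    rw [φ.apply_symm_apply]
    exact hdepth v
  · rw [← Finite.card_option, Nat.card_congr φ]
  · rw [← Nat.card_sum, Nat.card_congr ψ]

end GraphModel

section CWComplex

open Topology.CWComplex Metric

variable {X : Type*} [TopologicalSpace X] {C : Set X} [Topology.CWComplex C]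

/-- The point of the zero-dimensional cell `v`. -/
def cellVertex (v : cell C 0) : X := map 0 v ![]

/-- The characteristic map of the one-dimensional cell `e`, as a path on `[0, 1]`. -/
def cellEdge (e : cell C 1) (t : ℝ) : X := map 1 e fun _ => 2 * t - 1

lemma cellVertex_mem_openCell (v : cell C 0) : cellVertex v ∈ openCell 0 v := by
  rw [openCell_zero_eq_singleton]
  rfl

lemma const_mem_ball_iff {t : ℝ} :
    (fun _ => 2 * t - 1 : Fin 1 → ℝ) ∈ ball 0 1 ↔ t ∈ Ioo (0 : ℝ) 1 := by
  rw [mem_ball_zero_iff, pi_norm_const, Real.norm_eq_abs, abs_lt, mem_Ioo]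
  constructor <;> rintro ⟨h, h'⟩ <;> constructor <;> linarith

lemma const_mem_closedBall {t : ℝ} (ht : t ∈ Icc (0 : ℝ) 1) :
    (fun _ => 2 * t - 1 : Fin 1 → ℝ) ∈ closedBall 0 1 := by
  rw [mem_closedBall_zero_iff, pi_norm_const, Real.norm_eq_abs, abs_le]
  constructor <;> linarith [ht.1, ht.2]

lemma continuousOn_cellEdge (e : cell C 1) : ContinuousOn (cellEdge e) (Icc 0 1) :=
  (continuousOn 1 e).comp (by fun_prop) fun _ ht => const_mem_closedBall ht

lemma image_cellEdge_Ioo (e : cell C 1) : cellEdge e '' Ioo 0 1 = openCell 1 e := by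
  ext x
  constructor
  · rintro ⟨t, ht, rfl⟩
    exact ⟨_, const_mem_ball_iff.2 ht, rfl⟩
  · rintro ⟨y, hy, rfl⟩
    have hconst : y = fun _ => 2 * ((y 0 + 1) / 2) - 1 := by
      funext k
      rw [Subsingleton.elim k 0]
      ring
    rw [hconst] at hy ⊢
    exact ⟨_, const_mem_ball_iff.1 hy, rfl⟩

lemma cellEdge_mem_openCell (e : cell C 1) {t : ℝ} (ht : t ∈ Ioo (0 : ℝ) 1) :
    cellEdge e t ∈ openCell 1 e :=
  image_cellEdge_Ioo e ▸ mem_image_of_mem _ ht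

lemma exists_cellVertex_eq_of_mem_cellFrontier {e : cell C 1} {x : X} (hx : x ∈ cellFrontier 1 e) :
    ∃ v : cell C 0, cellVertex v = x := by
  obtain ⟨u, v, h⟩ := exists_cellFrontier_one_eq e
  rw [h, closedCell_zero_eq_singleton, closedCell_zero_eq_singleton] at hx
  exact hx.elim (fun h => ⟨u, h.symm⟩) fun h => ⟨v, h.symm⟩

lemma exists_cellVertex_eq_cellEdge_zero (e : cell C 1) :
    ∃ v : cell C 0, cellVertex v = cellEdge e 0 := by
  refine exists_cellVertex_eq_of_mem_cellFrontier (e := e) ?_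
  rw [cellFrontier_one_eq]
  exact ⟨-1, by simp, congrArg (map 1 e) (funext fun _ => by norm_num)⟩

lemma exists_cellVertex_eq_cellEdge_one (e : cell C 1) :
    ∃ v : cell C 0, cellVertex v = cellEdge e 1 := by
  refine exists_cellVertex_eq_of_mem_cellFrontier (e := e) ?_
  rw [cellFrontier_one_eq]
  exact ⟨1, by simp, congrArg (map 1 e) (funext fun _ => by norm_num)⟩

lemma cellEdge_inj {e e' : cell C 1} {t t' : ℝ} (ht : t ∈ Ioo (0 : ℝ) 1)
    (ht' : t' ∈ Ioo (0 : ℝ) 1) (h : cellEdge e t = cellEdge e' t') : e = e' ∧ t = t' := by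
  have hmeet : ¬ Disjoint (openCell 1 e) (openCell 1 e') :=
    not_disjoint_iff.2 ⟨_, cellEdge_mem_openCell e ht, h ▸ cellEdge_mem_openCell e' ht'⟩
  obtain rfl : e = e' := by simpa using eq_of_not_disjoint_openCell hmeet
  have hconst := (map 1 e).injOn (by rw [source_eq]; exact const_mem_ball_iff.2 ht)
    (by rw [source_eq]; exact const_mem_ball_iff.2 ht') h
  have := congrFun hconst 0
  exact ⟨rfl, by linarith⟩

lemma cellEdge_ne_cellVertex {e : cell C 1} {t : ℝ} {v : cell C 0} (ht : t ∈ Ioo (0 : ℝ) 1) :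
    cellEdge e t ≠ cellVertex v :=
  (disjoint_openCell_of_ne (by simp)).ne_of_mem (cellEdge_mem_openCell e ht)
    (cellVertex_mem_openCell v)

lemma exists_cell_eq (hdim : ∀ m : ℕ, 1 < m → IsEmpty (cell C m)) {x : X} (hx : x ∈ C) :
    (∃ v : cell C 0, cellVertex v = x) ∨
      ∃ e : cell C 1, ∃ t ∈ Ioo (0 : ℝ) 1, cellEdge e t = x := by
  rw [← iUnion_openCell_eq_complex (C := C)] at hx
  simp only [mem_iUnion] at hx
  obtain ⟨m, j, hj⟩ := hx
  match m, j, hj with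
  | 0, v, hv =>
    rw [openCell_zero_eq_singleton] at hv
    exact Or.inl ⟨v, hv.symm⟩
  | 1, e, he =>
    rw [← image_cellEdge_Ioo] at he
    exact Or.inr ⟨e, he⟩
  | m + 2, j, _ => exact ((hdim (m + 2) (by lia)).false j).elim

end CWComplex

open Topology.CWComplex in
lemma exists_graphModel {G : Type*} [TopologicalSpace G] [Topology.CWComplex (univ : Set G)]
    (hdim : ∀ m : ℕ, 1 < m → IsEmpty (cell (univ : Set G) m)) :
    Nonempty (GraphModel G (cell (univ : Set G) 0) (cell (univ : Set G) 1)) := by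
  choose src hsrc using exists_cellVertex_eq_cellEdge_zero (C := (univ : Set G))
  choose tgt htgt using exists_cellVertex_eq_cellEdge_one (C := (univ : Set G))
  exact ⟨{
    vertex := cellVertex
    edge := cellEdge
    src := src
    tgt := tgt
    continuousOn_edge := continuousOn_cellEdge
    edge_zero := fun e => (hsrc e).symm
    edge_one := fun e => (htgt e).symm
    vertex_injective := injective_map_zero univ
    edge_inj := cellEdge_inj
    edge_ne_vertex := cellEdge_ne_cellVertex
    exists_eq := fun x => exists_cell_eq hdim (mem_univ x) }⟩

lemma IsFiniteGraph.exists_rootedGraph.{u} {G : Type u} [TopologicalSpace G]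
    [Topology.CWComplex (univ : Set G)] (hG : IsFiniteGraph G) :
    ∃ N S : Type u, Finite N ∧ Finite S ∧ Nonempty (RootedGraph G N S) ∧
      graphEulerChar G = 1 - Nat.card S := by
  have := hG.t2
  have := hG.connected
  have := hG.finite
  have hfin : ∀ m, Finite (Topology.CWComplex.cell (univ : Set G) m) :=
    fun m => Topology.CWComplex.FiniteType.finite_cell (C := (univ : Set G)) m
  have := hfin 0
  have := hfin 1
  obtain ⟨M⟩ := exists_graphModel hG.dim_le_one
  obtain ⟨N, S, hN, hS, hR, hV, hE⟩ := M.exists_rootedGraph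
  refine ⟨N, S, hN, hS, hR, ?_⟩
  change (Nat.card (Topology.RelCWComplex.cell (univ : Set G) 0) : ℤ) -
    Nat.card (Topology.RelCWComplex.cell (univ : Set G) 1) = _
  rw [hV, hE]
  push_cast
  ring

section Conf

variable {G : Type*} [TopologicalSpace G] {n : ℕ}

lemma IsSection.isIdentifyingFunction {s : Conf n G → Conf (n + 1) G} (hs : IsSection s) :
    IsIdentifyingFunction fun x => (s x).1 (Fin.last n) := by
  refine ⟨(continuous_apply _).comp (continuous_subtype_val.comp hs.1), fun x i h => ?_⟩
  have hi : (s x).1 i.castSucc = x.1 i := congrFun (congrArg Subtype.val (congrFun hs.2 x)) i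
  exact (Fin.castSucc_lt_last i).ne ((s x).2 (hi.trans h.symm))

lemma IsIdentifyingFunction.exists_avoidsTokens [Nonempty G] {f : Conf n G → G}
    (hf : IsIdentifyingFunction f) : ∃ F : (Fin n → G) → G, AvoidsTokens F := by
  classical
  obtain ⟨p⟩ := ‹Nonempty G›
  let F : (Fin n → G) → G := fun x => if hx : Function.Injective x then f ⟨x, hx⟩ else p
  have hF : ∀ x : Conf n G, F x.1 = f x := fun x => dif_pos x.2
  refine ⟨F, ?_, fun x hx => (hF ⟨x, hx⟩).symm ▸ hf.2 ⟨x, hx⟩⟩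
  rw [continuousOn_iff_continuous_domRestrict]
  exact hf.1.congr fun x => (hF x).symm

end Conf

theorem theorem1 (G : Type*) [TopologicalSpace G] [Topology.CWComplex (Set.univ : Set G)]
    (hG : IsFiniteGraph G) (hχ : graphEulerChar G < 0)
    (n : ℕ) (hn : 2 - graphEulerChar G ≤ (n : ℤ)) :
    (¬ ∃ s : Conf n G → Conf (n + 1) G, IsSection s) ∧
      ¬ ∃ f : Conf n G → G, IsIdentifyingFunction f := by
  have hid : ¬ ∃ f : Conf n G → G, IsIdentifyingFunction f := by
    rintro ⟨f, hf⟩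
    have := hG.t2
    have := hG.connected
    obtain ⟨F, hF⟩ := hf.exists_avoidsTokens
    obtain ⟨N, S, _, _, ⟨R⟩, heuler⟩ := hG.exists_rootedGraph
    rw [heuler] at hχ hn
    have : Nontrivial S := Finite.one_lt_card_iff_nontrivial.1 (by lia)
    exact R.not_avoidsTokens F (by rw [Nat.card_fin]; lia) hF
  exact ⟨fun ⟨_, hs⟩ => hid ⟨_, hs.isIdentifyingFunction⟩, hid⟩
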